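/- Let $p=(p_k)_{k\ge0}$ be a probability distribution on $\{0,1,2,\dots\}$ and let $X_0,X_1,X_2,\dots$ be the stationary binary renewal process with run length distribution $p$: the process obtained from the stationary Markov chain on $\{0,1,2,\dots\}$ with transition probabilities $p_{0,i}=p_i$ $(i\ge 0)$ and $p_{i,i-1}=1$ $(i\ge1)$ by collapsing all states $i\ge1$ to $1$. Write $X_0^n=(X_0,\dots,X_n)$, let $\psi=\min\{t\ge0:X_t=0\}$, for $n\ge\psi$ let $\tau(X_0^n)$ be the $t\ge0$ such that $X_{n-t}=0$ and $X_i=1$ for $n-t<i\le n$, let $\sigma_i=\max\{l\ge0: X_j=1\text{ for } i<j\le i+l\}$ and $\theta_n=E(\sigma_n\mid X_0^n)$. Let $0<\gamma<1$ and let $\log$ denote the logarithm to base $2$. Put $\lambda_0^*=\psi$ and, for $n\ge1$, let $\lambda_n^*$ be the least $t>\lambda_{n-1}^*$ such that there is an $i$ with $\psi<i<\lfloor\log t\rfloor$ and $\tau(X_0^i)=\tau(X_0^t)$, and $$\bigl|\{\lfloor\log t\rfloor<j<2^{\lfloor\log t\rfloor}:\tau(X_0^j)=\tau(X_0^t)\}\bigr|\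 \ge\ 2^{\lfloor\log t\rfloor(1-\gamma)} .$$ For $n\ge1$ let $N_n=\lceil 2^{\lfloor\log\lambda_n^*\rfloor(1-\gamma)}\rceil$, let $\kappa_n^*$ be the least $K$ with $|\{\lfloor\log\lambda_n^*\rfloor<j\le K:\tau(X_0^j)=\tau(X_0^{\lambda_n^*})\}|=N_n$, and put $$h_n^*=\frac1{N_n}\sum_{i=\lfloor\log\lambda_n^*\rfloor+1}^{\kappa_n^*} I_{\{\tau(X_0^i)=\tau(X_0^{\lambda_n^*})\}}\,\sigma_i,\qquad \hat p_l^*(X_0^{\lambda_n^*})=\frac1{N_n}\sum_{i=\lfloor\log\lambda_n^*\rfloor+1}^{\kappa_n^*} I_{\{\tau(X_0^i)=\tau(X_0^{\lambda_n^*}),\ \sigma_i=l\}}\quad(l\ge0).$$ These depend on $\gamma$ and on the observed sequence only. **Theorem 2.** Assume that $\sum_{k=0}^\infty k^{\alpha+1}p_k<\infty$ for some real $\alpha>1$, and let $0<\gamma<1/3$. Then every $\sigma_n$ is integrable (so that $\theta_n$ is finite), and almost surely $$\lim_{n\to\infty}\frac{\lambda_n^*}{n}=1,\qquad \lim_{n\to\infty}\bigl|h_n^*-\theta_{\lambda_n^*}\bigr|=0,\qquad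 \lim_{n\to\infty}\sum_{l=0}^\infty\left|\hat p_l^*(X_0^{\lambda_n^*})-\frac{p_{l+\tau(X_0^{\lambda_n^*})}}{\sum_{i=\tau(X_0^{\lambda_n^*})}^\infty p_i}\right|=0 .$$ -/

import Mathlib

open MeasureTheory ProbabilityTheory Filter Topology

namespace BinaryRenewal

/-- Transition probabilities of the chain on `{0, 1, 2, …}`: from `0` jump to `j` with
probability `p j`, from `i + 1` move to `i`. -/
def transition (p : ℕ → ℝ) : ℕ → ℕ → ℝ
  | 0, j => p j
  | i + 1, j => if j = i then 1 else 0

/-- `ν` is the law, on path space, of a stationary Markov chain with the transition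
probabilities `transition p`. -/
structure IsStationaryChain (p : ℕ → ℝ) (ν : Measure (ℕ → ℕ)) : Prop where
  isProbabilityMeasure : IsProbabilityMeasure ν
  markov : ∀ (n : ℕ) (y : ℕ → ℕ),
    ν.real {w | ∀ i ≤ n + 1, w i = y i} =
      ν.real {w | ∀ i ≤ n, w i = y i} * transition p (y n) (y (n + 1))
  stationary : MeasurePreserving (fun (w : ℕ → ℕ) (n : ℕ) => w (n + 1)) ν ν

/-- Collapse all the states `i ≥ 1` to `1`. -/
def collapse (i : ℕ) : Fin 2 := if i = 0 then 0 else 1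

/-- `X` is a (stationary, classical) binary renewal process with run length distribution `p`:
it has the law of the collapsed stationary chain. -/
structure IsRenewalProcess {Ω : Type*} [MeasurableSpace Ω] (p : ℕ → ℝ) (P : Measure Ω)
    (X : ℕ → Ω → Fin 2) : Prop where
  measurable : ∀ n, Measurable (X n)
  law : ∃ ν : Measure (ℕ → ℕ), IsStationaryChain p ν ∧
    P.map (fun ω n => X n ω) = ν.map (fun w n => collapse (w n))

/-- The `t` with `x (n - t) = 0` and `x i = 1` for `n - t < i ≤ n`
(meaningful once a zero occurs among `x 0, …, x n`; then there is exactly one such `t`). -/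
noncomputable def tau (x : ℕ → Fin 2) (n : ℕ) : ℕ :=
  sInf {t | t ≤ n ∧ x (n - t) = 0 ∧ ∀ i, n - t < i → i ≤ n → x i = 1}

/-- The position of the first zero. -/
noncomputable def psi (x : ℕ → Fin 2) : ℕ := sInf {t | x t = 0}

/-- The residual waiting time at `i`: `max {l ≥ 0 : x j = 1 for i < j ≤ i + l}`. -/
noncomputable def sigma (x : ℕ → Fin 2) (i : ℕ) : ℕ :=
  sSup {l | ∀ j, i < j → j ≤ i + l → x j = 1}

/-- The condition under which we stop at time `t`; here `Nat.log 2 t` is `⌊log₂ t⌋`. -/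
def StopAt (γ : ℝ) (x : ℕ → Fin 2) (t : ℕ) : Prop :=
  (∃ i, psi x < i ∧ i < Nat.log 2 t ∧ tau x i = tau x t) ∧
  (2 : ℝ) ^ ((Nat.log 2 t : ℝ) * (1 - γ)) ≤
    (((Finset.Ioo (Nat.log 2 t) (2 ^ Nat.log 2 t)).filter
      (fun j => tau x j = tau x t)).card : ℝ)

/-- The stopping times `λ*_n`. -/
noncomputable def lambdaStar (γ : ℝ) (x : ℕ → Fin 2) : ℕ → ℕ
  | 0 => psi x
  | n + 1 => sInf {t | lambdaStar γ x n < t ∧ StopAt γ x t}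

/-- The number of occurrences `⌈2 ^ (⌊log₂ t⌋ (1 - γ))⌉` that are averaged at time `t`. -/
noncomputable def sampleSize (γ : ℝ) (t : ℕ) : ℕ :=
  ⌈(2 : ℝ) ^ ((Nat.log 2 t : ℝ) * (1 - γ))⌉₊

/-- The index `κ*_n`. -/
noncomputable def kappaStar (γ : ℝ) (x : ℕ → Fin 2) (n : ℕ) : ℕ :=
  sInf {K | ((Finset.Ioc (Nat.log 2 (lambdaStar γ x n)) K).filter
      (fun j => tau x j = tau x (lambdaStar γ x n))).card = sampleSize γ (lambdaStar γ x n)}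

/-- The estimator `h*_n` of the expected residual waiting time at time `λ*_n`. -/
noncomputable def hStar (γ : ℝ) (x : ℕ → Fin 2) (n : ℕ) : ℝ :=
  1 / (sampleSize γ (lambdaStar γ x n) : ℝ) *
    ∑ i ∈ Finset.Icc (Nat.log 2 (lambdaStar γ x n) + 1) (kappaStar γ x n),
      if tau x i = tau x (lambdaStar γ x n) then (sigma x i : ℝ) else 0

/-- The estimator `p̂*_l` of the residual waiting time distribution at time `λ*_n`. -/
noncomputable def pStar (γ : ℝ) (x : ℕ → Fin 2) (n l : ℕ) : ℝ :=
  1 / (sampleSize γ (lambdaStar γ x n) : ℝ) *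
    ∑ i ∈ Finset.Icc (Nat.log 2 (lambdaStar γ x n) + 1) (kappaStar γ x n),
      if tau x i = tau x (lambdaStar γ x n) ∧ sigma x i = l then (1 : ℝ) else 0

/-- The sample path of the process `X` at `ω`. -/
def path {Ω : Type*} (X : ℕ → Ω → Fin 2) (ω : Ω) : ℕ → Fin 2 := fun n => X n ω

/-- `θ_n = E(σ_n | X_0, …, X_n)`. -/
noncomputable def theta {Ω : Type*} [MeasurableSpace Ω] (P : Measure Ω) (X : ℕ → Ω → Fin 2)
    (n : ℕ) : Ω → ℝ :=
  P[fun ω => (sigma (path X ω) n : ℝ) |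
    MeasurableSpace.comap (fun ω (i : Fin (n + 1)) => X i ω) inferInstance]

end BinaryRenewal

/-!
The path is a concatenation of runs, and everything rests on the renewal property `IsRenewalLaw`:
on any event decided by time `s` on which `x s = 0`, the length `sigma x s` of the run that starts
at `s` has law `p` and is independent of the past. It is inherited from the chain, because almost
surely the state at time `s + 1` is exactly `sigma x s` (`sigma_collapse`). Stationarity enters only
in the integrability of `sigma`, where the stationary law is dominated by the tails of `p`.

At a zero all earlier runs are over, so centred functionals of the runs, summed over zeros that are
selected without looking at the runs they start, behave like sums of uncorrelated variables
(`IsRenewalLaw.integral_sq_sum`). All almost sure limits follow from second moments that are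
summable over the dyadic scale `L = ⌊log₂ t⌋`; no ergodic theorem is used.

* `lambdaStar n ∼ n`. The law of large numbers along the times `2 ^ L`
  (`IsRenewalLaw.ae_tendsto_sum_runs`) shows that zeros have positive lower density and that every
  age of positive probability occurs often enough to meet the stopping condition eventually. Hence
  that condition fails, apart from finitely many times, only at times of age at least `M`. Their
  upper density is at most a constant times the mean excess of a run length over `M`, for every `M`.

* The estimators. At a stopping time `t` with age `m` and `⌊log₂ t⌋ = L`, the sample consists of the
  first `N` runs that reach age `m` after time `L`, and `m` occurs already before time `L`. So only
  the pairs `(m, L)` with `m < L` matter. Write `S` for the probability that a run reaches age `m`.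
  The second moment of a residual waiting time given the age `m` is at most a constant over `S`,
  which is not bounded in `m`, but the age `m` is seen before time `L` with probability at most
  `L * S`, and the two factors `S` cancel (`IsRenewalLaw.integral_sq_selected_le`). The squared
  deviations of the sample means, summed over `m < L`, thus have expectation `O (L ^ 2 / N)`, which
  is summable in `L` because `N` is exponential in `L`. For the law of the residual waiting time the
  same bound is applied to all the indicators of `{l}` at once, with weights `(l + 1) ^ 2`, and
  Cauchy-Schwarz controls the `ℓ¹` distance.

* On the event that the age at time `n` is `m`, the renewal property identifies the conditional
  expectation `theta` with the mean residual waiting time at age `m` (`ae_theta_eq`).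
-/

namespace BinaryRenewal

/-! ### Combinatorics of a single binary path -/

section Path

variable {x y : ℕ → Fin 2}

lemma fin_two_eq_one {a : Fin 2} (h : a ≠ 0) : a = 1 := by omega

lemma apply_psi (h : ∃ t, x t = 0) : x (psi x) = 0 := Nat.sInf_mem (s := {t | x t = 0}) h

lemma psi_le {t : ℕ} (h : x t = 0) : psi x ≤ t := Nat.sInf_le (s := {t | x t = 0}) h

/-- The age `tau` is the distance to the last zero. -/
lemma tau_eq {s m : ℕ} (hs : x s = 0) (h1 : ∀ i, s < i → i ≤ s + m → x i = 1) :
    tau x (s + m) = m := by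
  have hset : {t | t ≤ s + m ∧ x (s + m - t) = 0 ∧
      ∀ i, s + m - t < i → i ≤ s + m → x i = 1} = {m} := by
    ext t
    simp only [Set.mem_ofPred_eq, Set.mem_singleton_iff]
    constructor
    · rintro ⟨h2, h3, h4⟩
      rcases lt_trichotomy t m with h | h | h
      · have := h1 (s + m - t) (by omega) (by omega)
        simp [h3] at this
      · exact h
      · have := h4 s (by omega) (by omega)
        simp [hs] at this
    · rintro rfl
      refine ⟨by omega, by simpa using hs, fun i hi hi' => h1 i (by omega) hi'⟩
  rw [tau, hset, csInf_singleton]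

lemma exists_last_zero {n : ℕ} (h : ∃ t, x t = 0) (hn : psi x ≤ n) :
    ∃ s ≤ n, x s = 0 ∧ ∀ i, s < i → i ≤ n → x i = 1 := by
  refine ⟨Nat.findGreatest (fun t => x t = 0) n, Nat.findGreatest_le n,
    Nat.findGreatest_spec (P := fun t => x t = 0) hn (apply_psi h), fun i hi hi' => ?_⟩
  exact fin_two_eq_one (Nat.findGreatest_is_greatest (P := fun t => x t = 0) hi hi')

lemma tau_spec {n : ℕ} (h : ∃ t, x t = 0) (hn : psi x ≤ n) :
    tau x n ≤ n ∧ x (n - tau x n) = 0 ∧ ∀ i, n - tau x n < i → i ≤ n → x i = 1 := by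
  obtain ⟨s, hs, h0, h1⟩ := exists_last_zero h hn
  have := tau_eq (m := n - s) h0 (by rwa [Nat.add_sub_cancel' hs])
  rw [Nat.add_sub_cancel' hs] at this
  rw [this, Nat.sub_sub_self hs]
  exact ⟨by omega, h0, h1⟩

lemma sigma_eq {i k : ℕ} (h1 : ∀ j, i < j → j ≤ i + k → x j = 1) (h0 : x (i + k + 1) = 0) :
    sigma x i = k := by
  have : IsGreatest {l | ∀ j, i < j → j ≤ i + l → x j = 1} k := by
    refine ⟨h1, fun l hl => ?_⟩
    by_contra hlt
    have := hl (i + k + 1) (by omega) (by omega)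
    simp [h0] at this
  exact this.csSup_eq

lemma exists_next_zero (hz : ∃ᶠ n in atTop, x n = 0) (i : ℕ) :
    ∃ k, (∀ j, i < j → j ≤ i + k → x j = 1) ∧ x (i + k + 1) = 0 := by
  have hex : ∃ k, x (i + k + 1) = 0 := by
    obtain ⟨n, hn, h0⟩ := (frequently_atTop.1 hz) (i + 1)
    exact ⟨n - i - 1, by rwa [show i + (n - i - 1) + 1 = n by omega]⟩
  classical
  refine ⟨Nat.find hex, fun j hj hj' => fin_two_eq_one fun h0 => ?_, Nat.find_spec hex⟩
  refine Nat.find_min hex (m := j - i - 1) (by omega) ?_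
  rwa [show i + (j - i - 1) + 1 = j by omega]

lemma sigma_spec (hz : ∃ᶠ n in atTop, x n = 0) (i : ℕ) :
    (∀ j, i < j → j ≤ i + sigma x i → x j = 1) ∧ x (i + sigma x i + 1) = 0 := by
  obtain ⟨k, h1, h0⟩ := exists_next_zero hz i
  rw [sigma_eq h1 h0]
  exact ⟨h1, h0⟩

lemma sigma_add (hz : ∃ᶠ n in atTop, x n = 0) {s m : ℕ} (h : m ≤ sigma x s) :
    sigma x (s + m) = sigma x s - m := by
  obtain ⟨h1, h0⟩ := sigma_spec hz s
  refine sigma_eq (fun j hj hj' => h1 j (by omega) (by omega)) ?_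
  rwa [show s + m + (sigma x s - m) + 1 = s + sigma x s + 1 by omega]

lemma tau_add (hz : ∃ᶠ n in atTop, x n = 0) {s m : ℕ} (hs : x s = 0) (h : m ≤ sigma x s) :
    tau x (s + m) = m :=
  tau_eq hs fun i hi hi' => (sigma_spec hz s).1 i hi (by omega)

/-- At a time `j` with age `tau x j`, the zero that started the current run is at
`j - tau x j`, and the run that it started has length at least `tau x j`. -/
lemma tau_zero (hz : ∃ᶠ n in atTop, x n = 0) {j : ℕ} (hj : psi x ≤ j) :
    tau x j ≤ j ∧ x (j - tau x j) = 0 ∧ tau x j ≤ sigma x (j - tau x j) := by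
  obtain ⟨h, h0, h1⟩ := tau_spec hz.exists hj
  refine ⟨h, h0, ?_⟩
  by_contra hlt
  have := h1 _ (show j - tau x j < j - tau x j + sigma x (j - tau x j) + 1 by omega) (by omega)
  rw [(sigma_spec hz _).2] at this
  simp at this

/-- A run started by an earlier zero is over when the next zero occurs. -/
lemma add_sigma_lt (hz : ∃ᶠ n in atTop, x n = 0) {i s : ℕ} (his : i < s) (hs : x s = 0) :
    i + sigma x i < s := by
  by_contra hlt
  have := (sigma_spec hz i).1 s his (by omega)
  simp [hs] at this

/-- If the times `i` and `s + m` both have age `m` and `i < s + m`, where `s` is the last zero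
before `s + m`, then already `i < s`. -/
lemma lt_of_tau_eq (hz : ∃ᶠ n in atTop, x n = 0) {i s m : ℕ} (hi : psi x ≤ i)
    (hs : x s = 0) (ht : tau x i = m) (his : i < s + m) : i < s := by
  obtain ⟨h, h0, h1⟩ := tau_spec hz.exists hi
  by_contra hlt
  have := h1 s (by omega) (by omega)
  simp [hs] at this

lemma dependsOn_tau (n : ℕ) : DependsOn (fun x => tau x n) (Set.Iic n) := by
  intro x y h
  have : ∀ t, (t ≤ n ∧ x (n - t) = 0 ∧ ∀ i, n - t < i → i ≤ n → x i = 1) ↔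
      (t ≤ n ∧ y (n - t) = 0 ∧ ∀ i, n - t < i → i ≤ n → y i = 1) := by
    intro t
    rw [h (n - t) (Nat.sub_le _ _)]
    refine and_congr_right fun _ => and_congr_right fun _ => ?_
    refine forall_congr' fun i => forall_congr' fun _ => forall_congr' fun hi => ?_
    rw [h i hi]
  simp only [tau, this]

lemma psi_congr {s : ℕ} (h : ∀ i ∈ Set.Iic s, x i = y i) (hs : x s = 0) : psi x = psi y := by
  have hys : y s = 0 := by rw [← h s (Set.mem_Iic.2 le_rfl), hs]
  apply le_antisymm
  · refine psi_le ?_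
    rw [h _ (psi_le hys)]; exact apply_psi ⟨s, hys⟩
  · refine psi_le ?_
    rw [← h _ (psi_le hs)]; exact apply_psi ⟨s, hs⟩

lemma sigma_congr {i s : ℕ} (h : ∀ i ∈ Set.Iic s, x i = y i) (hs : x s = 0) (his : i < s) :
    sigma x i = sigma y i := by
  have hys : y s = 0 := by rw [← h s (Set.mem_Iic.2 le_rfl), hs]
  have : ∀ l, (∀ j, i < j → j ≤ i + l → x j = 1) ↔ (∀ j, i < j → j ≤ i + l → y j = 1) := by
    intro l
    have key : ∀ {x y : ℕ → Fin 2}, (∀ i ∈ Set.Iic s, x i = y i) → x s = 0 →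
        (∀ j, i < j → j ≤ i + l → x j = 1) → (∀ j, i < j → j ≤ i + l → y j = 1) := by
      intro x y h hs h1 j hj hj'
      rcases le_or_gt s (i + l) with hl | hl
      · have := h1 s his hl
        simp [hs] at this
      · rw [← h j (by simp only [Set.mem_Iic]; omega)]; exact h1 j hj hj'
    exact ⟨key h hs, key (fun i hi => (h i hi).symm) hys⟩
  simp only [sigma, this]

end Path

section Measurability

/-- A function of finitely many coordinates factors through a finite restriction. -/
lemma _root_.DependsOn.exists_comp_frestrictLe {π β : Type*} [Nonempty π]
    {f : (ℕ → π) → β} {s : ℕ} (hf : DependsOn f (Set.Iic s)) :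
    ∃ g : ((i : Finset.Iic s) → π) → β, f = g ∘ Preorder.frestrictLe (π := fun _ : ℕ => π) s := by
  classical
  refine ⟨fun a => f fun i => if h : i ∈ Finset.Iic s then a ⟨i, h⟩ else Classical.arbitrary π, ?_⟩
  funext x
  refine hf fun i hi => ?_
  have hi' : i ∈ Finset.Iic s := by simpa using hi
  simp only [dif_pos hi']
  rfl

lemma _root_.DependsOn.measurable {π β : Type*} [Nonempty π] [Countable π] [MeasurableSpace π]
    [MeasurableSingletonClass π] [MeasurableSpace β] {f : (ℕ → π) → β} {s : ℕ}
    (hf : DependsOn f (Set.Iic s)) : Measurable f := by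
  obtain ⟨g, rfl⟩ := hf.exists_comp_frestrictLe
  exact (measurable_of_countable g).comp (Preorder.measurable_frestrictLe (X := fun _ => π) s)

lemma measurableSet_of_dependsOn {C : Set (ℕ → Fin 2)} {s : ℕ}
    (hC : DependsOn (fun x => x ∈ C) (Set.Iic s)) : MeasurableSet C :=
  measurableSet_setOfPred.2 hC.measurable

lemma measurable_sigma (i : ℕ) : Measurable (fun x => sigma x i) := by
  have hpos : ∀ k, MeasurableSet
      {x : ℕ → Fin 2 | (∀ j, i < j → j ≤ i + k → x j = 1) ∧ x (i + k + 1) = 0} := by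
    intro k
    refine measurableSet_of_dependsOn (s := i + k + 1) fun x y h => ?_
    simp only [Set.mem_ofPred_eq]
    rw [h (i + k + 1) (Set.mem_Iic.2 le_rfl)]
    refine congrArg (· ∧ _) ?_
    refine forall_congr fun j => ?_
    refine propext ⟨fun H h1 h2 => ?_, fun H h1 h2 => ?_⟩
    · rw [← h j (by simp only [Set.mem_Iic]; omega)]; exact H h1 h2
    · rw [h j (by simp only [Set.mem_Iic]; omega)]; exact H h1 h2
  -- off the countable union of these sets the path is constantly one after `i`, and `sigma`
  -- takes the single value assigned to an unbounded set
  have hne : ∀ x : ℕ → Fin 2,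
      (∀ k, ¬ ((∀ j, i < j → j ≤ i + k → x j = 1) ∧ x (i + k + 1) = 0)) → sigma x i = 0 := by
    intro x hx
    have hall : ∀ k, ∀ j, i < j → j ≤ i + k → x j = 1 := by
      intro k
      induction k with
      | zero => intro j h1 h2; omega
      | succ k ih =>
        intro j h1 h2
        rcases Nat.lt_or_ge j (i + k + 1) with h | h
        · exact ih j h1 (by omega)
        · have : j = i + k + 1 := by omega
          subst this
          exact fin_two_eq_one fun h0 => hx k ⟨ih, h0⟩
    have : {l | ∀ j, i < j → j ≤ i + l → x j = 1} = Set.univ := by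
      ext l; simpa using hall l
    rw [sigma, this]
    exact Nat.sSup_of_not_bddAbove (by simp)
  refine measurable_to_countable' fun k => ?_
  have : (fun x => sigma x i) ⁻¹' {k} =
      {x : ℕ → Fin 2 | (∀ j, i < j → j ≤ i + k → x j = 1) ∧ x (i + k + 1) = 0} ∪
      ({x | k = 0} ∩ ⋂ k, {x : ℕ → Fin 2 | (∀ j, i < j → j ≤ i + k → x j = 1) ∧
        x (i + k + 1) = 0}ᶜ) := by
    ext x
    simp only [Set.mem_preimage, Set.mem_singleton_iff, Set.mem_union, Set.mem_ofPred_eq,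
      Set.mem_inter_iff, Set.mem_iInter, Set.mem_compl_iff]
    constructor
    · rintro h
      by_cases hx : ∃ k, (∀ j, i < j → j ≤ i + k → x j = 1) ∧ x (i + k + 1) = 0
      · obtain ⟨k', hk'⟩ := hx
        have := sigma_eq hk'.1 hk'.2
        left
        rw [← h, this]; exact hk'
      · push Not at hx
        have hx' : ∀ k, ¬ ((∀ j, i < j → j ≤ i + k → x j = 1) ∧ x (i + k + 1) = 0) :=
          fun k hk => hx k hk.1 hk.2
        exact Or.inr ⟨by rw [← h, hne x hx'], hx'⟩
    · rintro (h | ⟨rfl, h⟩)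
      · exact sigma_eq h.1 h.2
      · exact hne x h
  rw [this]
  exact (hpos k).union ((MeasurableSet.const _).inter (MeasurableSet.iInter fun k => (hpos k).compl))

end Measurability

/-! ### From the stationary chain to the renewal property -/

section Chain

variable {p : ℕ → ℝ} {ν : Measure (ℕ → ℕ)}

lemma IsStationaryChain.markov_enn (hν : IsStationaryChain p ν) (hp : ∀ k, 0 ≤ p k) (n : ℕ)
    (y : ℕ → ℕ) : ν {w | ∀ i ≤ n + 1, w i = y i} =
      ν {w | ∀ i ≤ n, w i = y i} * ENNReal.ofReal (transition p (y n) (y (n + 1))) := by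
  have := hν.isProbabilityMeasure
  have h := congrArg ENNReal.ofReal (hν.markov n y)
  have h0 : 0 ≤ transition p (y n) (y (n + 1)) := by
    unfold transition
    split
    · exact hp _
    · split <;> norm_num
  rwa [ENNReal.ofReal_mul measureReal_nonneg, ofReal_measureReal, ofReal_measureReal] at h

lemma preimage_frestrictLe_singleton {π : Type*} (n : ℕ) (y : ℕ → π) :
    Preorder.frestrictLe (π := fun _ : ℕ => π) n ⁻¹' {Preorder.frestrictLe n y} =
      {w | ∀ i ≤ n, w i = y i} := by
  ext w
  simp only [Set.mem_preimage, Set.mem_singleton_iff, Set.mem_ofPred_eq, funext_iff]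
  constructor
  · intro h i hi
    exact h ⟨i, by simpa using hi⟩
  · intro h i
    exact h i (Finset.mem_Iic.1 i.2)

/-- Almost every point has only prefixes of positive probability. -/
lemma ae_prefix_pos {π : Type*} [Countable π] [MeasurableSpace π] [MeasurableSingletonClass π]
    (ν : Measure (ℕ → π)) : ∀ᵐ y ∂ν, ∀ n, ν {w | ∀ i ≤ n, w i = y i} ≠ 0 := by
  refine ae_all_iff.2 fun n => ?_
  have hset : {y : ℕ → π | ν {w | ∀ i ≤ n, w i = y i} = 0} =
      ⋃ a ∈ {a | ν (Preorder.frestrictLe (π := fun _ : ℕ => π) n ⁻¹' {a}) = 0},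
        Preorder.frestrictLe (π := fun _ : ℕ => π) n ⁻¹' {a} := by
    ext y
    simp only [Set.mem_ofPred_eq, Set.mem_iUnion, Set.mem_preimage, Set.mem_singleton_iff,
      exists_prop, exists_eq_right', preimage_frestrictLe_singleton]
  rw [ae_iff]
  simp only [not_not]
  rw [hset]
  exact (measure_biUnion_null_iff (Set.to_countable _)).2 fun a ha => ha

/-- Almost every path of the chain descends by one step from each nonzero state. -/
lemma IsStationaryChain.ae_descent (hν : IsStationaryChain p ν) (hp : ∀ k, 0 ≤ p k) :
    ∀ᵐ w ∂ν, ∀ n, w n ≠ 0 → w n = w (n + 1) + 1 := by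
  filter_upwards [ae_prefix_pos ν] with w hw n hn
  have h := hw (n + 1)
  rw [hν.markov_enn hp] at h
  by_contra hne
  obtain ⟨i, hi⟩ := Nat.exists_eq_succ_of_ne_zero hn
  refine h ?_
  have : transition p (w n) (w (n + 1)) = 0 := by
    rw [hi]
    simp only [transition]
    rw [if_neg]
    omega
  simp [this]

lemma descent_sub {w : ℕ → ℕ} (hw : ∀ n, w n ≠ 0 → w n = w (n + 1) + 1) (n j : ℕ)
    (hj : j ≤ w n) : w (n + j) = w n - j := by
  induction j with
  | zero => simp
  | succ j ih =>
    have h1 := ih (by omega)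
    have h2 := hw (n + j) (by omega)
    rw [← add_assoc]
    omega

lemma collapse_eq_zero {i : ℕ} : collapse i = 0 ↔ i = 0 := by
  unfold collapse; split <;> simp_all

lemma collapse_eq_one {i : ℕ} : collapse i = 1 ↔ i ≠ 0 := by
  unfold collapse; split <;> simp_all

lemma frequently_zero_of_descent {w : ℕ → ℕ} (hw : ∀ n, w n ≠ 0 → w n = w (n + 1) + 1) :
    ∃ᶠ n in atTop, collapse (w n) = 0 := by
  refine frequently_atTop.2 fun n => ⟨n + w n, by omega, ?_⟩
  rw [collapse_eq_zero, descent_sub hw n _ le_rfl, Nat.sub_self]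

/-- The next state of the chain is the residual waiting time. -/
lemma sigma_collapse {w : ℕ → ℕ} (hw : ∀ n, w n ≠ 0 → w n = w (n + 1) + 1) (s : ℕ) :
    sigma (fun n => collapse (w n)) s = w (s + 1) := by
  refine sigma_eq (fun j hj hj' => ?_) ?_
  · rw [collapse_eq_one]
    have := descent_sub hw (s + 1) (j - (s + 1)) (by omega)
    rw [show s + 1 + (j - (s + 1)) = j by omega] at this
    omega
  · rw [collapse_eq_zero, show s + w (s + 1) + 1 = s + 1 + w (s + 1) by omega,
      descent_sub hw (s + 1) _ le_rfl, Nat.sub_self]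

/-- The state after a visit to zero is independent of the past and has law `p`. -/
lemma IsStationaryChain.measure_inter_succ (hν : IsStationaryChain p ν) (hp : ∀ k, 0 ≤ p k)
    (s k : ℕ) {B : Set (ℕ → ℕ)} (hB : DependsOn (fun w => w ∈ B) (Set.Iic s))
    (hB0 : ∀ w ∈ B, w s = 0) :
    ν (B ∩ {w | w (s + 1) = k}) = ν B * ENNReal.ofReal (p k) := by
  set π := Preorder.frestrictLe (π := fun _ : ℕ => ℕ) s with hπ
  have hπm : Measurable π := Preorder.measurable_frestrictLe (X := fun _ => ℕ) s
  have hm0 : MeasurableSet {w : ℕ → ℕ | w s = 0} :=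
    measurable_pi_apply s (measurableSet_singleton 0)
  have hmk : MeasurableSet {w : ℕ → ℕ | w (s + 1) = k} :=
    measurable_pi_apply (X := fun _ => ℕ) (s + 1) (measurableSet_singleton k)
  have heq : (ν.restrict ({w | w s = 0} ∩ {w | w (s + 1) = k})).map π =
      ENNReal.ofReal (p k) • (ν.restrict {w | w s = 0}).map π := by
    refine Measure.ext_of_singleton fun a => ?_
    obtain ⟨y, rfl⟩ : ∃ y, π y = a := by
      refine ⟨fun i => if h : i ∈ Finset.Iic s then a ⟨i, h⟩ else 0, ?_⟩
      funext i
      exact dif_pos i.2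
    have hms : MeasurableSet (π ⁻¹' {π y}) := hπm (measurableSet_singleton _)
    rw [Measure.smul_apply, Measure.map_apply hπm (measurableSet_singleton _),
      Measure.map_apply hπm (measurableSet_singleton _), Measure.restrict_apply hms,
      Measure.restrict_apply hms, preimage_frestrictLe_singleton, smul_eq_mul, mul_comm]
    by_cases h0 : y s = 0
    · have hk := hν.markov_enn hp s (fun i => if i = s + 1 then k else y i)
      have e1 : {w : ℕ → ℕ | ∀ i ≤ s, w i = if i = s + 1 then k else y i} =
          {w | ∀ i ≤ s, w i = y i} ∩ {w | w s = 0} := by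
        ext w
        simp only [Set.mem_ofPred_eq, Set.mem_inter_iff]
        constructor
        · intro h
          refine ⟨fun i hi => ?_, ?_⟩
          · rw [h i hi, if_neg (by omega)]
          · rw [h s le_rfl, if_neg (by omega), h0]
        · intro h i hi
          rw [h.1 i hi, if_neg (by omega)]
      have e2 : {w : ℕ → ℕ | ∀ i ≤ s + 1, w i = if i = s + 1 then k else y i} =
          {w | ∀ i ≤ s, w i = y i} ∩ ({w | w s = 0} ∩ {w | w (s + 1) = k}) := by
        ext w
        simp only [Set.mem_ofPred_eq, Set.mem_inter_iff]
        constructor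
        · intro h
          refine ⟨fun i hi => ?_, ?_, ?_⟩
          · rw [h i (by omega), if_neg (by omega)]
          · rw [h s (by omega), if_neg (by omega), h0]
          · rw [h (s + 1) le_rfl, if_pos rfl]
        · rintro ⟨h1, -, h2⟩ i hi
          split
          · subst i; exact h2
          · exact h1 i (by omega)
      rw [e1, e2] at hk
      simpa [h0, transition] using hk
    · have e1 : {w : ℕ → ℕ | ∀ i ≤ s, w i = y i} ∩ {w | w s = 0} = ∅ := by
        ext w
        simp only [Set.mem_ofPred_eq, Set.mem_inter_iff, Set.mem_empty_iff_false, iff_false]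
        rintro ⟨h1, h2⟩
        exact h0 ((h1 s le_rfl).symm.trans h2)
      rw [← Set.inter_assoc, e1]
      simp
  obtain ⟨g, hg⟩ := hB.exists_comp_frestrictLe
  have hBset : B = π ⁻¹' {a | g a} := by
    ext w
    exact iff_of_eq (congrFun hg w)
  have hsub : B ∩ {w | w s = 0} = B := Set.inter_eq_left.2 hB0
  have hmg : MeasurableSet {a | g a} := (Set.to_countable _).measurableSet
  have h := congrArg (fun m => m {a | g a}) heq
  simp only [Measure.smul_apply, smul_eq_mul] at h
  rw [Measure.map_apply hπm hmg, Measure.map_apply hπm hmg, Measure.restrict_apply (hπm hmg),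
    Measure.restrict_apply (hπm hmg), ← hBset, ← Set.inter_assoc, hsub] at h
  rw [h, mul_comm]

lemma measurable_collapse_path : Measurable fun (w : ℕ → ℕ) n => collapse (w n) :=
  measurable_pi_lambda _ fun n => (measurable_of_countable collapse).comp (measurable_pi_apply n)

end Chain

/-- The regenerative property of the law `μ` of a binary path: almost surely there are infinitely
many zeros, and the run started by a zero at time `s` has law `p` and is independent of the past.
Stationarity is not part of this notion. -/
structure IsRenewalLaw (p : ℕ → ℝ) (μ : Measure (ℕ → Fin 2)) : Prop where
  isProbabilityMeasure : IsProbabilityMeasure μ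
  frequently_zero : ∀ᵐ x ∂μ, ∃ᶠ n in atTop, x n = 0
  renewal : ∀ (s k : ℕ) (C : Set (ℕ → Fin 2)), DependsOn (fun x => x ∈ C) (Set.Iic s) →
    (∀ x ∈ C, x s = 0) → μ (C ∩ {x | sigma x s = k}) = μ C * ENNReal.ofReal (p k)

lemma IsStationaryChain.isRenewalLaw {p : ℕ → ℝ} {ν : Measure (ℕ → ℕ)}
    (hν : IsStationaryChain p ν) (hp : ∀ k, 0 ≤ p k) :
    IsRenewalLaw p (ν.map fun w n => collapse (w n)) where
  isProbabilityMeasure := by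
    have := hν.isProbabilityMeasure
    exact Measure.isProbabilityMeasure_map measurable_collapse_path.aemeasurable
  frequently_zero := by
    have hm : MeasurableSet {x : ℕ → Fin 2 | ∃ᶠ n in atTop, x n = 0} := by
      simp only [frequently_atTop]
      refine measurableSet_setOfPred.2 (Measurable.forall fun a => Measurable.exists fun b => ?_)
      exact measurableSet_setOfPred.1 ((MeasurableSet.const _).inter
        (measurable_pi_apply (X := fun _ => Fin 2) b (measurableSet_singleton 0)))
    refine (ae_map_iff measurable_collapse_path.aemeasurable hm).2 ?_
    filter_upwards [hν.ae_descent hp] with w hw using frequently_zero_of_descent hw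
  renewal := by
    intro s k C hC hC0
    have hmC := measurableSet_of_dependsOn hC
    have hms : MeasurableSet {x : ℕ → Fin 2 | sigma x s = k} :=
      measurable_sigma s (measurableSet_singleton k)
    rw [Measure.map_apply measurable_collapse_path (hmC.inter hms),
      Measure.map_apply measurable_collapse_path hmC,
      ← hν.measure_inter_succ hp s k (B := (fun (w : ℕ → ℕ) n => collapse (w n)) ⁻¹' C)]
    · refine measure_congr ?_
      filter_upwards [hν.ae_descent hp] with w hw
      refine propext (and_congr_right fun _ => ?_)
      change sigma (fun n => collapse (w n)) s = k ↔ w (s + 1) = k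
      rw [sigma_collapse hw]
    · intro w w' h
      exact hC fun i hi => by simp only [h i hi]
    · intro w hw
      exact collapse_eq_zero.1 (hC0 _ hw)

/-! ### Integrability of the residual waiting time -/

lemma rpow_mul_tail_le {p : ℕ → ℝ} (hp : ∀ k, 0 ≤ p k) (hps : Summable p) {a : ℝ} (ha : 0 ≤ a)
    (hm : Summable fun k : ℕ => (k : ℝ) ^ a * p k) (i : ℕ) :
    (i : ℝ) ^ a * ∑' k, p (k + i) ≤ ∑' k : ℕ, (k : ℝ) ^ a * p k := by
  rw [← tsum_mul_left]
  have h1 : Summable fun k : ℕ => ((k + i : ℕ) : ℝ) ^ a * p (k + i) :=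
    (summable_nat_add_iff (f := fun k : ℕ => (k : ℝ) ^ a * p k) i).2 hm
  have h2 : Summable fun k : ℕ => (i : ℝ) ^ a * p (k + i) :=
    ((summable_nat_add_iff (f := p) i).2 hps).mul_left _
  calc ∑' k : ℕ, (i : ℝ) ^ a * p (k + i) ≤ ∑' k : ℕ, ((k + i : ℕ) : ℝ) ^ a * p (k + i) := by
        refine h2.tsum_le_tsum (fun k => ?_) h1
        gcongr
        · exact hp _
        · omega
    _ ≤ ∑' k : ℕ, (k : ℝ) ^ a * p k := by
        rw [← hm.sum_add_tsum_nat_add i]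
        refine le_add_of_nonneg_left (Finset.sum_nonneg fun k _ => ?_)
        have := hp k
        positivity

namespace IsStationaryChain

variable {p : ℕ → ℝ} {ν : Measure (ℕ → ℕ)}

lemma measure_zero_eq (hν : IsStationaryChain p ν) (hp : ∀ k, 0 ≤ p k) (i : ℕ) :
    ν.real {w | w 0 = i} = ν.real {w | w 0 = 0} * p i + ν.real {w | w 0 = i + 1} := by
  have := hν.isProbabilityMeasure
  have hm : ∀ n j, MeasurableSet {w : ℕ → ℕ | w n = j} := fun n j =>
    measurable_pi_apply (X := fun _ => ℕ) n (measurableSet_singleton j)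
  have h1 : ν.real {w | w 0 = i} = ν.real {w | w 1 = i} := by
    rw [measureReal_def, measureReal_def,
      ← hν.stationary.measure_preimage (hm 0 i).nullMeasurableSet]
    rfl
  have h2 : ν.real ({w | w 0 = 0} ∩ {w | w 1 = i}) = ν.real {w | w 0 = 0} * p i := by
    have := hν.measure_inter_succ hp 0 i (B := {w | w 0 = 0})
      (fun w w' h => by
        have h0 := h 0 (by simp)
        simp only [Set.mem_ofPred_eq, h0]) (fun w hw => hw)
    rw [measureReal_def, this, ENNReal.toReal_mul, ENNReal.toReal_ofReal (hp i), measureReal_def]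
  have h3 : ν.real {w | w 1 = i} =
      ν.real (({w | w 0 = 0} ∩ {w | w 1 = i}) ∪ {w | w 0 = i + 1}) := by
    refine measureReal_congr ?_
    filter_upwards [hν.ae_descent hp] with w hw
    have h := hw 0
    refine propext ?_
    change w 1 = i ↔ (w 0 = 0 ∧ w 1 = i) ∨ w 0 = i + 1
    rw [zero_add] at h
    omega
  rw [h1, h3, measureReal_union _ (hm 0 _), h2]
  rw [Set.disjoint_left]
  rintro w ⟨h, -⟩ h'
  simp only [Set.mem_ofPred_eq] at h h'
  omega

/-- The stationary law is dominated by the tails of `p`. -/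
lemma measure_zero_le (hν : IsStationaryChain p ν) (hp : ∀ k, 0 ≤ p k) (hps : Summable p)
    (i : ℕ) : ν.real {w | w 0 = i} ≤ ∑' k, p (k + i) := by
  have := hν.isProbabilityMeasure
  have hm : ∀ j, MeasurableSet {w : ℕ → ℕ | w 0 = j} := fun j =>
    measurable_pi_apply (X := fun _ => ℕ) 0 (measurableSet_singleton j)
  have hstep : ∀ K, ν.real {w | w 0 = i} ≤ ∑' k, p (k + i) + ν.real {w | w 0 = i + K} := by
    intro K
    have h : ν.real {w | w 0 = i} = ν.real {w | w 0 = 0} * ∑ k ∈ Finset.range K, p (k + i) +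
        ν.real {w | w 0 = i + K} := by
      induction K with
      | zero => simp
      | succ K ih =>
        rw [ih, hν.measure_zero_eq hp (i + K), Finset.sum_range_succ, add_comm K i, mul_add, add_assoc,
          add_assoc]
    rw [h]
    gcongr
    have h1 : ∑ k ∈ Finset.range K, p (k + i) ≤ ∑' k, p (k + i) :=
      ((summable_nat_add_iff i).2 hps).sum_le_tsum _ fun k _ => hp _
    have h2 : 0 ≤ ∑ k ∈ Finset.range K, p (k + i) := Finset.sum_nonneg fun k _ => hp _
    have h3 : ν.real {w | w 0 = 0} ≤ 1 := measureReal_le_one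
    nlinarith
  have hsum : Summable fun j => ν.real {w : ℕ → ℕ | w 0 = j} := by
    refine ENNReal.summable_toReal ?_
    rw [← measure_iUnion (fun a b hab => ?_) hm]
    · exact measure_ne_top _ _
    · rw [Function.onFun, Set.disjoint_left]
      intro w h h'
      exact hab (h.symm.trans h')
  have htend : Tendsto (fun K => ∑' k, p (k + i) + ν.real {w : ℕ → ℕ | w 0 = i + K}) atTop
      (𝓝 (∑' k, p (k + i) + 0)) := by
    refine tendsto_const_nhds.add ?_
    have := (tendsto_add_atTop_iff_nat i).2 hsum.tendsto_atTop_zero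
    simpa only [add_comm] using this
  rw [add_zero] at htend
  exact ge_of_tendsto' htend hstep

lemma integrable_apply (hν : IsStationaryChain p ν) (hp : ∀ k, 0 ≤ p k) (hps : Summable p)
    {α : ℝ} (hα : 1 < α) (hm : Summable fun k : ℕ => (k : ℝ) ^ (α + 1) * p k) (n : ℕ) :
    Integrable (fun w : ℕ → ℕ => (w n : ℝ)) ν := by
  induction n with
  | succ n ih =>
    have := hν.stationary.integrable_comp_of_integrable ih
    exact this
  | zero =>
    have := hν.isProbabilityMeasure
    have hmeas : Measurable fun w : ℕ → ℕ => w 0 := measurable_pi_apply 0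
    have hI : Integrable (fun k : ℕ => (k : ℝ)) (ν.map fun w => w 0) := by
      refine ⟨(measurable_of_countable _).aestronglyMeasurable, ?_⟩
      rw [HasFiniteIntegral, lintegral_countable']
      have hle : ∀ k : ℕ, ‖(k : ℝ)‖ₑ * (ν.map fun w => w 0) {k} ≤
          ENNReal.ofReal ((∑' k : ℕ, (k : ℝ) ^ (α + 1) * p k) * (1 / (k : ℝ) ^ α)) := by
        intro k
        have hk : (ν.map fun w => w 0) {k} = ENNReal.ofReal (ν.real {w | w 0 = k}) := by
          rw [Measure.map_apply hmeas (measurableSet_singleton k), ofReal_measureReal]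
          rfl
        rw [hk, Real.enorm_eq_ofReal (by positivity), ← ENNReal.ofReal_mul (by positivity)]
        refine ENNReal.ofReal_le_ofReal ?_
        rcases Nat.eq_zero_or_pos k with rfl | hkpos
        · rw [Nat.cast_zero, zero_mul]
          have : 0 ≤ ∑' k : ℕ, (k : ℝ) ^ (α + 1) * p k :=
            tsum_nonneg fun k => mul_nonneg (by positivity) (hp k)
          positivity
        · have hk0 : (0 : ℝ) < k := by exact_mod_cast hkpos
          have h1 := hν.measure_zero_le hp hps k
          have h2 := rpow_mul_tail_le hp hps (by linarith : 0 ≤ α + 1) hm k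
          rw [mul_one_div, le_div_iff₀ (by positivity)]
          calc (k : ℝ) * ν.real {w | w 0 = k} * (k : ℝ) ^ α
              = (k : ℝ) ^ (α + 1) * ν.real {w | w 0 = k} := by
                rw [Real.rpow_add_one hk0.ne']; ring
            _ ≤ (k : ℝ) ^ (α + 1) * ∑' j, p (j + k) := by gcongr
            _ ≤ _ := h2
      refine (ENNReal.tsum_le_tsum hle).trans_lt ?_
      have hs : Summable fun k : ℕ =>
          (∑' k : ℕ, (k : ℝ) ^ (α + 1) * p k) * (1 / (k : ℝ) ^ α) :=
        (Real.summable_one_div_nat_rpow.2 hα).mul_left _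
      exact hs.tsum_ofReal_lt_top
    exact hI.comp_measurable hmeas

/-- Under a moment of order `α + 1` with `α > 1` the residual waiting times are integrable. -/
lemma integrable_sigma (hν : IsStationaryChain p ν) (hp : ∀ k, 0 ≤ p k) (hps : Summable p)
    {α : ℝ} (hα : 1 < α) (hm : Summable fun k : ℕ => (k : ℝ) ^ (α + 1) * p k) (n : ℕ) :
    Integrable (fun x => (sigma x n : ℝ)) (ν.map fun w n => collapse (w n)) := by
  refine (integrable_map_measure (measurable_from_nat.comp
    (measurable_sigma n)).aestronglyMeasurable measurable_collapse_path.aemeasurable).2 ?_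
  refine (hν.integrable_apply hp hps hα hm (n + 1)).congr ?_
  filter_upwards [hν.ae_descent hp] with w hw
  simp only [Function.comp_apply, sigma_collapse hw]

end IsStationaryChain

/-! ### Orthogonality of centred run functionals -/

/-- The law of a run length, as a measure on `ℕ`. -/
noncomputable def runLaw (p : ℕ → ℝ) : Measure ℕ :=
  Measure.sum fun k => ENNReal.ofReal (p k) • Measure.dirac k

lemma runLaw_singleton (p : ℕ → ℝ) (k : ℕ) : runLaw p {k} = ENNReal.ofReal (p k) := by
  rw [runLaw, Measure.sum_apply _ (measurableSet_singleton k), tsum_eq_single k]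
  · simp
  · intro j hj
    simp [hj]

lemma isProbabilityMeasure_runLaw {p : ℕ → ℝ} (hp : ∀ k, 0 ≤ p k) (hs : HasSum p 1) :
    IsProbabilityMeasure (runLaw p) :=
  hs.isProbabilityMeasure_sum_dirac hp

lemma integral_runLaw {p : ℕ → ℝ} (hp : ∀ k, 0 ≤ p k) (g : ℕ → ℝ) :
    ∫ k, g k ∂runLaw p = ∑' k, p k * g k := by
  rw [runLaw, integral_sum_dirac (by simp)]
  simp [ENNReal.toReal_ofReal (hp _)]

lemma integrable_runLaw {p : ℕ → ℝ} (hp : ∀ k, 0 ≤ p k) {g : ℕ → ℝ}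
    (hg : Summable fun k => p k * |g k|) : Integrable g (runLaw p) := by
  refine integrable_sum_dirac (by simp) ?_
  simpa [ENNReal.toReal_ofReal (hp _)] using hg

namespace IsRenewalLaw

variable {p : ℕ → ℝ} {μ : Measure (ℕ → Fin 2)}

/-- On the event of a zero at time `s`, the path up to time `s` and the run that follows are
independent, and the run has law `runLaw p`. -/
lemma map_prefix_sigma (h : IsRenewalLaw p μ) (hp : ∀ k, 0 ≤ p k) (hs : HasSum p 1) (s : ℕ) :
    (μ.restrict {x | x s = 0}).map
      (fun x => (Preorder.frestrictLe (π := fun _ : ℕ => Fin 2) s x, sigma x s)) =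
    ((μ.restrict {x | x s = 0}).map (Preorder.frestrictLe (π := fun _ : ℕ => Fin 2) s)).prod
      (runLaw p) := by
  have := h.isProbabilityMeasure
  have := isProbabilityMeasure_runLaw hp hs
  set π := Preorder.frestrictLe (π := fun _ : ℕ => Fin 2) s
  have hπm : Measurable π := Preorder.measurable_frestrictLe (X := fun _ => Fin 2) s
  refine Measure.ext_of_singleton fun ⟨a, k⟩ => ?_
  rw [← Set.singleton_prod_singleton, Measure.prod_prod,
    Measure.map_apply (hπm.prodMk (measurable_sigma s))
      ((measurableSet_singleton a).prod (measurableSet_singleton k)),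
    Measure.map_apply hπm (measurableSet_singleton a),
    Measure.restrict_apply (hπm.prodMk (measurable_sigma s)
      ((measurableSet_singleton a).prod (measurableSet_singleton k))),
    Measure.restrict_apply (hπm (measurableSet_singleton a)), runLaw_singleton]
  rw [← h.renewal s k (π ⁻¹' {a} ∩ {x | x s = 0})]
  · congr 1
    ext x
    simp only [Set.mem_inter_iff, Set.mem_preimage, Set.mem_prod, Set.mem_singleton_iff,
      Set.mem_ofPred_eq]
    tauto
  · intro x y hxy
    have h1 : π x = π y := Preorder.dependsOn_frestrictLe s hxy
    simp only [Set.mem_inter_iff, Set.mem_preimage, Set.mem_ofPred_eq, h1,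
      hxy s (Set.mem_Iic.2 le_rfl)]
  · exact fun x hx => hx.2

variable {s : ℕ} {φ : (ℕ → Fin 2) → ℝ} {g : ℕ → ℝ}

/-- The product formula behind all second moment computations: a function of the path up to a zero at
time `s` and a function of the run started at `s` integrate as a product. -/
lemma integrable_mul_sigma (h : IsRenewalLaw p μ) (hp : ∀ k, 0 ≤ p k) (hs : HasSum p 1)
    (hφ : DependsOn φ (Set.Iic s)) (hφ0 : ∀ x, x s ≠ 0 → φ x = 0) (hg : Integrable g (runLaw p)) :
    Integrable (fun x => φ x * g (sigma x s)) μ ∧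
      ∫ x, φ x * g (sigma x s) ∂μ = (∫ x, φ x ∂μ) * ∫ k, g k ∂runLaw p := by
  have := h.isProbabilityMeasure
  have := isProbabilityMeasure_runLaw hp hs
  obtain ⟨ψ, hψ⟩ := hφ.exists_comp_frestrictLe
  set π := Preorder.frestrictLe (π := fun _ : ℕ => Fin 2) s
  have hπm : Measurable π := Preorder.measurable_frestrictLe (X := fun _ => Fin 2) s
  have hpair : Measurable fun x => (π x, sigma x s) := hπm.prodMk (measurable_sigma s)
  have hm0 : MeasurableSet {x : ℕ → Fin 2 | x s = 0} :=
    measurable_pi_apply (X := fun _ => Fin 2) s (measurableSet_singleton 0)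
  have hsupp : ∀ f : (ℕ → Fin 2) → ℝ,
      Function.support (fun x => φ x * f x) ⊆ {x | x s = 0} := by
    intro f x hx
    by_contra hne
    exact hx (by simp [hφ0 x hne])
  have hsupp' : Function.support φ ⊆ {x | x s = 0} := by
    intro x hx
    by_contra hne
    exact hx (hφ0 x hne)
  have hψi : Integrable ψ ((μ.restrict {x | x s = 0}).map π) := Integrable.of_finite
  have hprod := hψi.mul_prod hg
  rw [← h.map_prefix_sigma hp hs s] at hprod
  have hint := hprod.comp_measurable hpair
  constructor
  · rw [← integrableOn_iff_integrable_of_support_subset (hsupp fun x => g (sigma x s)), hψ]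
    exact hint
  · rw [← setIntegral_eq_integral_of_forall_compl_eq_zero (s := {x | x s = 0})
        (fun x hx => by rw [hφ0 x hx, zero_mul]),
      ← setIntegral_eq_integral_of_forall_compl_eq_zero (f := φ)
        (s := {x | x s = 0}) (fun x hx => hφ0 x hx)]
    have h1 : ∫ x in {x | x s = 0}, φ x * g (sigma x s) ∂μ =
        ∫ z, ψ z.1 * g z.2 ∂((μ.restrict {x | x s = 0}).map fun x => (π x, sigma x s)) := by
      rw [integral_map hpair.aemeasurable (measurable_of_countable _).aestronglyMeasurable, hψ]
      rfl
    rw [h1, h.map_prefix_sigma hp hs s, integral_prod_mul,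
      integral_map hπm.aemeasurable (measurable_of_countable _).aestronglyMeasurable, hψ]
    rfl

/-- Orthogonality: sums of a centred functional of the runs, taken over zeros that are selected
without looking at the runs they start, have the second moment of uncorrelated summands. -/
lemma integral_sq_sum (h : IsRenewalLaw p μ) (hp : ∀ k, 0 ≤ p k) (hs : HasSum p 1)
    {H : ℕ → Set (ℕ → Fin 2)} (hH : ∀ s, DependsOn (fun x => x ∈ H s) (Set.Iic s))
    (hH0 : ∀ s, ∀ x ∈ H s, x s = 0) (hg2 : Summable fun k => p k * g k ^ 2)
    (hg0 : ∑' k, p k * g k = 0) (T : ℕ) :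
    Integrable (fun x =>
      (∑ s ∈ Finset.range T, (H s).indicator 1 x * g (sigma x s)) ^ 2) μ ∧
    ∫ x, (∑ s ∈ Finset.range T, (H s).indicator 1 x * g (sigma x s)) ^ 2 ∂μ =
      (∑ s ∈ Finset.range T, μ.real (H s)) * ∑' k, p k * g k ^ 2 := by
  have := h.isProbabilityMeasure
  have hgi2 : Integrable (fun k => g k ^ 2) (runLaw p) := integrable_runLaw hp (by simpa using hg2)
  have hgi : Integrable g (runLaw p) := by
    refine integrable_runLaw hp (((hs.summable.add hg2)).of_nonneg_of_le
      (fun k => mul_nonneg (hp k) (abs_nonneg _)) fun k => ?_)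
    have := hp k
    have h1 : |g k| ≤ 1 + g k ^ 2 := by
      rw [← sq_abs]; nlinarith [sq_nonneg (|g k| - 1), abs_nonneg (g k)]
    nlinarith
  have hdep : ∀ s, DependsOn ((H s).indicator (1 : (ℕ → Fin 2) → ℝ)) (Set.Iic s) := by
    intro s x y hxy
    have hiff : x ∈ H s ↔ y ∈ H s := iff_of_eq (hH s hxy)
    by_cases hx : x ∈ H s
    · simp [hx, hiff.1 hx]
    · simp [hx, mt hiff.2 hx]
  have hvan : ∀ s x, x s ≠ 0 → (H s).indicator (1 : (ℕ → Fin 2) → ℝ) x = 0 := by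
    intro s x hx
    exact Set.indicator_of_notMem (fun hm => hx (hH0 s x hm)) _
  induction T with
  | zero => simp
  | succ T ih =>
    set D : (ℕ → Fin 2) → ℝ :=
      fun x => ∑ s ∈ Finset.range T, (H s).indicator 1 x * g (sigma x s) with hD
    -- at a zero, the earlier runs are over and the partial sum is known
    have hDdep : DependsOn (fun x => 2 * D x * (H T).indicator 1 x) (Set.Iic T) := by
      intro x y hxy
      by_cases hxT : x T = 0
      · have e1 : D x = D y := by
          refine Finset.sum_congr rfl fun s hs => ?_
          have hsT := Finset.mem_range.1 hs
          rw [hdep s fun i hi => hxy i (by simp only [Set.mem_Iic] at hi ⊢; omega),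
            sigma_congr hxy hxT hsT]
        simp only [e1, hdep T hxy]
      · have hyT : y T ≠ 0 := by rwa [← hxy T (Set.mem_Iic.2 le_rfl)]
        simp only [hvan T x hxT, hvan T y hyT, mul_zero]
    obtain ⟨i1, e1⟩ := h.integrable_mul_sigma hp hs hDdep
      (fun x hx => by rw [hvan T x hx, mul_zero]) hgi
    obtain ⟨i2, e2⟩ := h.integrable_mul_sigma hp hs (hdep T) (hvan T) hgi2
    rw [integral_runLaw hp, hg0, mul_zero] at e1
    rw [integral_runLaw hp, integral_indicator_one (measurableSet_of_dependsOn (hH T))] at e2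
    have hexp : ∀ x, (∑ s ∈ Finset.range (T + 1), (H s).indicator 1 x * g (sigma x s)) ^ 2 =
        D x ^ 2 + 2 * D x * (H T).indicator 1 x * g (sigma x T) +
          (H T).indicator 1 x * g (sigma x T) ^ 2 := by
      intro x
      have hsq : (H T).indicator (1 : (ℕ → Fin 2) → ℝ) x ^ 2 = (H T).indicator 1 x := by
        by_cases hx : x ∈ H T <;> simp [hx]
      rw [Finset.sum_range_succ]
      change (D x + _) ^ 2 = _
      rw [add_sq, mul_pow, hsq]
      ring
    simp only [hexp]
    have i0 : Integrable (fun x => D x ^ 2) μ := ih.1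
    have e0 : ∫ x, D x ^ 2 ∂μ = _ := ih.2
    have i01 : Integrable
      (fun x => D x ^ 2 + 2 * D x * (H T).indicator 1 x * g (sigma x T)) μ := i0.add i1
    refine ⟨i01.add i2, ?_⟩
    rw [integral_add i01 i2, integral_add i0 i1, e0, e1, e2, Finset.sum_range_succ]
    ring

end IsRenewalLaw

/-- Nonnegative measurable functions with summable integrals tend to zero almost everywhere. -/
lemma ae_tendsto_zero_of_tsum_lintegral {X : Type*} [MeasurableSpace X] {μ : Measure X}
    {F : ℕ → X → ENNReal} (hF : ∀ n, AEMeasurable (F n) μ) (h : ∑' n, ∫⁻ x, F n x ∂μ ≠ ⊤) :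
    ∀ᵐ x ∂μ, Tendsto (fun n => F n x) atTop (𝓝 0) := by
  rw [← lintegral_tsum hF] at h
  filter_upwards [ae_lt_top' (AEMeasurable.tsum hF) h] with x hx
  exact ENNReal.tendsto_atTop_zero_of_tsum_ne_top hx.ne

/-! ### A law of large numbers along powers of two -/

lemma summable_mul_of_sq {q f : ℕ → ℝ} (hq : ∀ k, 0 ≤ q k) (hs : Summable q)
    (hf : Summable fun k => q k * f k ^ 2) : Summable fun k => q k * f k := by
  refine Summable.of_norm_bounded (hs.add hf) fun k => ?_
  have h1 : |f k| ≤ 1 + f k ^ 2 := by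
    rw [← sq_abs]; nlinarith [sq_nonneg (|f k| - 1), abs_nonneg (f k)]
  rw [Real.norm_eq_abs, abs_mul, abs_of_nonneg (hq k)]
  nlinarith [hq k]

/-- The law of large numbers, along the times `2 ^ L`, for the functional `f` of the runs of the
path `x`. -/
def RunAverages (p : ℕ → ℝ) (f : ℕ → ℝ) (x : ℕ → Fin 2) : Prop :=
  Tendsto (fun L : ℕ =>
    (∑ s ∈ (Finset.range (2 ^ L)).filter (fun s => x s = 0), f (sigma x s) -
      (∑' k, p k * f k) * ((Finset.range (2 ^ L)).filter (fun s => x s = 0)).card) / 2 ^ L)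
    atTop (𝓝 0)

namespace IsRenewalLaw

variable {p : ℕ → ℝ} {μ : Measure (ℕ → Fin 2)}

/-- Along the times `2 ^ L`, a square integrable functional of the runs, summed over the runs
started so far, is asymptotically its mean times the number of runs. Chebyshev's inequality
suffices on this geometric sequence of times. -/
lemma ae_tendsto_sum_runs (h : IsRenewalLaw p μ) (hp : ∀ k, 0 ≤ p k) (hs : HasSum p 1)
    {f : ℕ → ℝ} (hf : Summable fun k => p k * f k ^ 2) :
    ∀ᵐ x ∂μ, RunAverages p f x := by
  have := h.isProbabilityMeasure
  set e := ∑' k, p k * f k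
  set g : ℕ → ℝ := fun k => f k - e with hg
  have hf1 := summable_mul_of_sq hp hs.summable hf
  have hg0 : ∑' k, p k * g k = 0 := by
    have h1 : HasSum (fun k => p k * f k - p k * e) (e - 1 * e) := hf1.hasSum.sub (hs.mul_right e)
    simp only [hg, mul_sub]
    rw [h1.tsum_eq]; ring
  have hg2 : Summable fun k => p k * g k ^ 2 := by
    refine ((hf.mul_left 2).add (hs.summable.mul_left (2 * e ^ 2))).of_nonneg_of_le
      (fun k => mul_nonneg (hp k) (sq_nonneg _)) fun k => ?_
    simp only [hg]
    nlinarith [hp k, mul_nonneg (hp k) (sq_nonneg (f k + e))]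
  set v := ∑' k, p k * g k ^ 2
  have hv : 0 ≤ v := tsum_nonneg fun k => mul_nonneg (hp k) (sq_nonneg _)
  set D : ℕ → (ℕ → Fin 2) → ℝ := fun L x =>
    ∑ s ∈ Finset.range (2 ^ L), {x : ℕ → Fin 2 | x s = 0}.indicator 1 x * g (sigma x s) with hD
  have hmain : ∀ L, Integrable (fun x => D L x ^ 2) μ ∧ ∫ x, D L x ^ 2 ∂μ ≤ 2 ^ L * v := by
    intro L
    obtain ⟨h1, h2⟩ := h.integral_sq_sum hp hs (H := fun s => {x | x s = 0})
      (fun s x y hxy => by simp only [Set.mem_ofPred_eq, hxy s (Set.mem_Iic.2 le_rfl)])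
      (fun s x hx => hx) hg2 hg0 (2 ^ L)
    refine ⟨h1, h2.trans_le ?_⟩
    gcongr
    calc ∑ s ∈ Finset.range (2 ^ L), μ.real {x | x s = 0} ≤ ∑ s ∈ Finset.range (2 ^ L), (1 : ℝ) :=
          Finset.sum_le_sum fun s _ => measureReal_le_one
      _ = 2 ^ L := by simp
  have hae := ae_tendsto_zero_of_tsum_lintegral (μ := μ)
    (F := fun L x => ENNReal.ofReal (D L x ^ 2 / 4 ^ L))
    (fun L => ((hmain L).1.div_const _).aestronglyMeasurable.aemeasurable.ennreal_ofReal) (by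
      have hle : ∀ L, ∫⁻ x, ENNReal.ofReal (D L x ^ 2 / 4 ^ L) ∂μ ≤
          ENNReal.ofReal (v * (1 / 2) ^ L) := by
        intro L
        rw [← ofReal_integral_eq_lintegral_ofReal ((hmain L).1.div_const _)
          (ae_of_all _ fun x => by positivity), integral_div]
        refine ENNReal.ofReal_le_ofReal ?_
        rw [div_le_iff₀ (by positivity)]
        refine (hmain L).2.trans (le_of_eq ?_)
        rw [mul_assoc, ← mul_pow, mul_comm]
        norm_num
      refine ne_top_of_le_ne_top ?_ (ENNReal.tsum_le_tsum hle)
      exact ((summable_geometric_of_lt_one (by norm_num) (by norm_num)).mul_left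
        v).tsum_ofReal_ne_top)
  filter_upwards [hae] with x hx
  unfold RunAverages
  have h1 : Tendsto (fun L => D L x ^ 2 / 4 ^ L) atTop (𝓝 0) := by
    have := (ENNReal.tendsto_toReal ENNReal.zero_ne_top).comp hx
    refine this.congr fun L => ?_
    exact ENNReal.toReal_ofReal (by positivity)
  have h2 : Tendsto (fun L => |D L x / 2 ^ L|) atTop (𝓝 0) := by
    have := (Real.continuous_sqrt.tendsto 0).comp h1
    rw [Real.sqrt_zero] at this
    refine this.congr fun L => ?_
    have h4 : (4 : ℝ) ^ L = (2 ^ L) ^ 2 := by rw [← pow_mul, mul_comm, pow_mul]; norm_num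
    simp only [Function.comp_apply]
    rw [h4, ← div_pow, Real.sqrt_sq_eq_abs]
  refine ((tendsto_zero_iff_abs_tendsto_zero _).2 h2).congr fun L => ?_
  congr 1
  simp only [hD, Set.indicator_apply, Set.mem_ofPred_eq, Pi.one_apply, ite_mul, one_mul, zero_mul]
  rw [← Finset.sum_filter]
  simp only [hg, Finset.sum_sub_distrib, Finset.sum_const, nsmul_eq_mul]
  ring

end IsRenewalLaw

/-! ### Conditional laws of the residual waiting time -/

/-- The mean of `f` under the law `l ↦ p (l + m) / ∑ i, p (i + m)` of the residual waiting time
given the age `m`; it is zero if the age `m` has probability zero. -/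
noncomputable def residualMean (p : ℕ → ℝ) (m : ℕ) (f : ℕ → ℝ) : ℝ :=
  (∑' l, p (l + m) * f l) / ∑' i, p (i + m)

/-- The functional `f` of the residual waiting time at age `m`, centred at its conditional mean
and seen as a functional of the whole run length `r`. -/
noncomputable def centred (p : ℕ → ℝ) (m : ℕ) (f : ℕ → ℝ) (r : ℕ) : ℝ :=
  if m ≤ r then f (r - m) - residualMean p m f else 0

section Centred

variable {p : ℕ → ℝ} {m : ℕ} {f : ℕ → ℝ}

lemma hasSum_of_eq_zero_of_lt {F : ℕ → ℝ} {a : ℝ} (h0 : ∀ r < m, F r = 0)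
    (h : HasSum (fun l => F (l + m)) a) : HasSum F a := by
  have := (hasSum_nat_add_iff m).1 h
  rwa [Finset.sum_eq_zero (fun r hr => h0 r (Finset.mem_range.1 hr)), add_zero] at this

lemma hasSum_mul_indicator_Ici (hs : Summable p) (m : ℕ) :
    HasSum (fun k => p k * (Set.Ici m).indicator (1 : ℕ → ℝ) k) (∑' i, p (i + m)) := by
  refine hasSum_of_eq_zero_of_lt (m := m) (fun r hr => by simp [hr]) ?_
  simpa using ((summable_nat_add_iff m).2 hs).hasSum

lemma centred_add (l : ℕ) : centred p m f (l + m) = f l - residualMean p m f := by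
  simp [centred]

lemma centred_of_lt {r : ℕ} (h : r < m) : centred p m f r = 0 := by
  simp [centred, h]

lemma residualMean_mul (hp : ∀ k, 0 ≤ p k) (hs : Summable p) :
    residualMean p m f * ∑' i, p (i + m) = ∑' l, p (l + m) * f l := by
  by_cases h0 : ∑' i, p (i + m) = 0
  · have hz : ∀ l, p (l + m) = 0 := by
      have := (hasSum_zero_iff_of_nonneg (fun l => hp (l + m))).1
        (h0 ▸ ((summable_nat_add_iff m).2 hs).hasSum)
      exact fun l => congrFun this l
    simp [hz]
  · rw [residualMean, div_mul_cancel₀ _ h0]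

lemma hasSum_centred (hp : ∀ k, 0 ≤ p k) (hs : Summable p)
    (hf : Summable fun l => p (l + m) * f l ^ 2) :
    HasSum (fun r => p r * centred p m f r) 0 := by
  have hsm := (summable_nat_add_iff m).2 hs
  refine hasSum_of_eq_zero_of_lt (m := m) (fun r hr => by rw [centred_of_lt hr, mul_zero]) ?_
  simp only [centred_add, mul_sub]
  have h1 := (summable_mul_of_sq (fun l => hp (l + m)) hsm hf).hasSum
  have h2 := h1.sub (hsm.hasSum.mul_right (residualMean p m f))
  rwa [← residualMean_mul hp hs, mul_comm, sub_self] at h2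

lemma hasSum_centred_sq (hp : ∀ k, 0 ≤ p k) (hs : Summable p)
    (hf : Summable fun l => p (l + m) * f l ^ 2) :
    HasSum (fun r => p r * centred p m f r ^ 2)
      (∑' l, p (l + m) * f l ^ 2 - residualMean p m f ^ 2 * ∑' i, p (i + m)) := by
  have hsm := (summable_nat_add_iff m).2 hs
  refine hasSum_of_eq_zero_of_lt (m := m) (fun r hr => by rw [centred_of_lt hr]; ring) ?_
  simp only [centred_add]
  have h1 := (summable_mul_of_sq (fun l => hp (l + m)) hsm hf).hasSum
  have h2 := (hf.hasSum.sub (h1.mul_left (2 * residualMean p m f))).add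
    (hsm.hasSum.mul_left (residualMean p m f ^ 2))
  rw [← residualMean_mul (f := f) hp hs] at h2
  refine Eq.mpr (congrArg₂ (fun F a => HasSum F a) ?_ ?_) h2
  · funext l; ring
  · ring

lemma tsum_centred_sq_le (hp : ∀ k, 0 ≤ p k) (hs : Summable p)
    (hf : Summable fun l => p (l + m) * f l ^ 2) :
    ∑' r, p r * centred p m f r ^ 2 ≤ ∑' l, p (l + m) * f l ^ 2 := by
  rw [(hasSum_centred_sq hp hs hf).tsum_eq]
  have : 0 ≤ ∑' i, p (i + m) := tsum_nonneg fun i => hp _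
  nlinarith [mul_nonneg (sq_nonneg (residualMean p m f)) this]

end Centred

/-! ### The sampled runs -/

/-- The event, decided at time `s`, that a zero at `s` starts a run which is sampled if it reaches
age `m`: the age `m` was seen before time `L`, it would be reached again after time `L`, and at most
`N - 1` of its occurrences after `L` precede it. -/
def selected (m L N s : ℕ) : Set (ℕ → Fin 2) :=
  {x | x s = 0 ∧ L < s + m ∧ (∃ i, psi x < i ∧ i < L ∧ i < s ∧ tau x i = m) ∧
    ((Finset.Ioo L s).filter (fun j => tau x j = m)).card < N}

/-- The normalized centred sum of `f` over the selected runs. If `N` runs are sampled, it is the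
deviation of their sample mean from the conditional mean. -/
noncomputable def deviation (p : ℕ → ℝ) (x : ℕ → Fin 2) (m L N : ℕ) (f : ℕ → ℝ) : ℝ :=
  (∑ s ∈ Finset.range (2 ^ L), (selected m L N s).indicator 1 x * centred p m f (sigma x s)) / N

lemma dependsOn_selected (m L N s : ℕ) :
    DependsOn (fun x => x ∈ selected m L N s) (Set.Iic s) := by
  have key : ∀ x y : ℕ → Fin 2, (∀ i ∈ Set.Iic s, x i = y i) → x ∈ selected m L N s →
      y ∈ selected m L N s := by
    rintro x y hxy ⟨h0, h1, ⟨i, h2, h3, h4, h5⟩, h6⟩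
    have htau : ∀ j ≤ s, tau y j = tau x j := fun j hj =>
      (dependsOn_tau j fun i hi => (hxy i (le_trans hi hj)).symm)
    refine ⟨by rw [← hxy s (Set.mem_Iic.2 le_rfl), h0], h1,
      ⟨i, by rwa [← psi_congr hxy h0], h3, h4, by rw [htau i h4.le, h5]⟩, ?_⟩
    rwa [Finset.filter_congr fun j hj => by rw [htau j (Finset.mem_Ioo.1 hj).2.le]]
  exact fun x y hxy => propext ⟨key x y hxy, key y x fun i hi => (hxy i hi).symm⟩

/-- At most `N` sampled runs reach age `m`, and none does if the age `m` was not reached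
before time `L`. -/
lemma sum_selected_le {x : ℕ → Fin 2} (hz : ∃ᶠ n in atTop, x n = 0) (m L N T : ℕ) :
    ∑ s ∈ Finset.range T, (selected m L N s).indicator (1 : (ℕ → Fin 2) → ℝ) x *
        (Set.Ici m).indicator 1 (sigma x s) ≤
      N * ∑ z ∈ Finset.range L, ({x : ℕ → Fin 2 | x z = 0}.indicator 1 x *
        (Set.Ici m).indicator 1 (sigma x z)) := by
  classical
  set S := (Finset.range T).filter (fun s => x ∈ selected m L N s ∧ m ≤ sigma x s) with hS
  have hl : ∑ s ∈ Finset.range T, (selected m L N s).indicator (1 : (ℕ → Fin 2) → ℝ) x *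
      (Set.Ici m).indicator 1 (sigma x s) = S.card := by
    rw [Finset.card_eq_sum_ones, hS, Finset.sum_filter]
    push_cast
    refine Finset.sum_congr rfl fun s _ => ?_
    by_cases h1 : x ∈ selected m L N s <;> by_cases h2 : m ≤ sigma x s <;> simp [h1, h2]
  have hnn : ∀ z, 0 ≤ ({x : ℕ → Fin 2 | x z = 0}.indicator 1 x *
      (Set.Ici m).indicator 1 (sigma x z) : ℝ) := fun z =>
    mul_nonneg (Set.indicator_nonneg (fun _ _ => zero_le_one) _)
      (Set.indicator_nonneg (fun _ _ => zero_le_one) _)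
  rw [hl]
  rcases S.eq_empty_or_nonempty with he | hne
  · rw [he]
    simpa using mul_nonneg (Nat.cast_nonneg (α := ℝ) N) (Finset.sum_nonneg fun z _ => hnn z)
  · -- all but the last element of `S` are counted in the definition of `selected`
    have hmax := S.max'_mem hne
    obtain ⟨-, ⟨h0, h1, ⟨i, h2, h3, h4, h5⟩, h6⟩, -⟩ := Finset.mem_filter.1 hmax
    have hcard : S.card ≤ N := by
      have hinj : (S.erase (S.max' hne)).card ≤
          ((Finset.Ioo L (S.max' hne)).filter (fun j => tau x j = m)).card := by
        refine Finset.card_le_card_of_injOn (fun s => s + m) (fun s hs => ?_)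
          (fun a _ b _ hab => by simpa using hab)
        obtain ⟨hs1, hs2⟩ := Finset.mem_erase.1 hs
        obtain ⟨-, ⟨g0, g1, -, -⟩, g2⟩ := Finset.mem_filter.1 hs2
        have hlt : s < S.max' hne := lt_of_le_of_ne (S.le_max' s hs2) hs1
        have := add_sigma_lt hz hlt h0
        refine Finset.mem_coe.2 (Finset.mem_filter.2 ⟨Finset.mem_Ioo.2 ⟨g1, ?_⟩, ?_⟩)
        · change s + m < _; omega
        · exact tau_add hz g0 g2
      rw [Finset.card_erase_of_mem hmax] at hinj
      omega
    obtain ⟨k1, k2, k3⟩ := tau_zero hz h2.le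
    rw [h5] at k1 k2 k3
    have hone : (1 : ℝ) ≤ ∑ z ∈ Finset.range L, ({x : ℕ → Fin 2 | x z = 0}.indicator 1 x *
        (Set.Ici m).indicator 1 (sigma x z)) := by
      refine le_trans ?_ (Finset.single_le_sum (fun z _ => hnn z)
        (Finset.mem_range.2 (by omega : i - m < L)))
      simp [k2, k3]
    calc (S.card : ℝ) ≤ N * 1 := by rw [mul_one]; exact_mod_cast hcard
      _ ≤ _ := by gcongr

namespace IsRenewalLaw

variable {p : ℕ → ℝ} {μ : Measure (ℕ → Fin 2)}

lemma integral_indicator_runs (h : IsRenewalLaw p μ) (hp : ∀ k, 0 ≤ p k) (hs : HasSum p 1)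
    {H : Set (ℕ → Fin 2)} {s : ℕ} (hH : DependsOn (fun x => x ∈ H) (Set.Iic s))
    (hH0 : ∀ x ∈ H, x s = 0) (m : ℕ) :
    Integrable (fun x => H.indicator (1 : (ℕ → Fin 2) → ℝ) x *
        (Set.Ici m).indicator 1 (sigma x s)) μ ∧
    ∫ x, H.indicator (1 : (ℕ → Fin 2) → ℝ) x * (Set.Ici m).indicator 1 (sigma x s) ∂μ =
      μ.real H * ∑' i, p (i + m) := by
  have hsum := hasSum_mul_indicator_Ici hs.summable m
  have hint : Integrable ((Set.Ici m).indicator (1 : ℕ → ℝ)) (runLaw p) := by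
    refine integrable_runLaw hp (hsum.summable.congr fun k => ?_)
    have h0 : 0 ≤ (Set.Ici m).indicator (1 : ℕ → ℝ) k :=
      Set.indicator_nonneg (fun _ _ => zero_le_one) _
    rw [abs_of_nonneg h0]
  have := h.integrable_mul_sigma hp hs (φ := H.indicator 1) (s := s) (fun x y hxy => by
      have hiff : x ∈ H ↔ y ∈ H := iff_of_eq (hH hxy)
      by_cases hx : x ∈ H
      · simp [hx, hiff.1 hx]
      · simp [hx, mt hiff.2 hx])
    (fun x hx => Set.indicator_of_notMem (fun hm => hx (hH0 x hm)) _) hint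
  rwa [integral_indicator_one (measurableSet_of_dependsOn hH), integral_runLaw hp,
    hsum.tsum_eq] at this

/-- The expected number of selected zeros, up to the probability of reaching age `m`. This is
where it matters that the age `m` was seen before time `L`. -/
lemma sum_measure_selected_mul_le (h : IsRenewalLaw p μ) (hp : ∀ k, 0 ≤ p k) (hs : HasSum p 1)
    (m L N T : ℕ) :
    (∑ s ∈ Finset.range T, μ.real (selected m L N s)) * ∑' i, p (i + m) ≤
      N * L * ∑' i, p (i + m) := by
  have := h.isProbabilityMeasure
  have h1 := fun s => h.integral_indicator_runs hp hs (dependsOn_selected m L N s)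
    (fun x hx => hx.1) m
  have h2 := fun z => h.integral_indicator_runs hp hs (H := {x | x z = 0}) (s := z)
    (fun x y hxy => by simp only [Set.mem_ofPred_eq, hxy z (Set.mem_Iic.2 le_rfl)])
    (fun x hx => hx) m
  have hS : 0 ≤ ∑' i, p (i + m) := tsum_nonneg fun i => hp _
  rw [Finset.sum_mul, ← Finset.sum_congr rfl fun s _ => (h1 s).2,
    ← integral_finsetSum _ fun s _ => (h1 s).1]
  refine (integral_mono_ae (integrable_finsetSum _ fun s _ => (h1 s).1)
    ((integrable_finsetSum _ fun z _ => (h2 z).1).const_mul (N : ℝ))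
    (h.frequently_zero.mono fun x hx => sum_selected_le hx m L N T)).trans ?_
  rw [integral_const_mul, integral_finsetSum _ fun z _ => (h2 z).1,
    Finset.sum_congr rfl fun z _ => (h2 z).2, mul_assoc]
  gcongr
  calc ∑ z ∈ Finset.range L, μ.real {x | x z = 0} * ∑' i, p (i + m)
      ≤ ∑ z ∈ Finset.range L, ∑' i, p (i + m) :=
        Finset.sum_le_sum fun z _ => mul_le_of_le_one_left hS measureReal_le_one
    _ = _ := by simp

/-- The centred sum over the sampled runs has second moment at most `N * L` times the
unnormalized second moment `∑' l, p (l + m) * f l ^ 2`: the number of selected zeros needed for `N`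
runs that reach age `m` is inversely proportional to the tail `∑' i, p (i + m)`, but zeros are
selected only if the age `m` is seen before time `L`, which has probability at most `L` times
that tail. -/
lemma integral_sq_selected_le (h : IsRenewalLaw p μ) (hp : ∀ k, 0 ≤ p k) (hs : HasSum p 1)
    {m : ℕ} {f : ℕ → ℝ} (hf : Summable fun l => p (l + m) * f l ^ 2) (L N T : ℕ) :
    Integrable (fun x => (∑ s ∈ Finset.range T,
      (selected m L N s).indicator 1 x * centred p m f (sigma x s)) ^ 2) μ ∧
    ∫ x, (∑ s ∈ Finset.range T,
      (selected m L N s).indicator 1 x * centred p m f (sigma x s)) ^ 2 ∂μ ≤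
      N * L * ∑' l, p (l + m) * f l ^ 2 := by
  obtain ⟨h1, h2⟩ := h.integral_sq_sum hp hs (dependsOn_selected m L N)
    (fun s x hx => hx.1) (hasSum_centred_sq hp hs.summable hf).summable
    (hasSum_centred hp hs.summable hf).tsum_eq T
  refine ⟨h1, h2.trans_le ?_⟩
  have hv := tsum_centred_sq_le hp hs.summable hf
  have hnn : 0 ≤ ∑' l, p (l + m) * f l ^ 2 :=
    tsum_nonneg fun l => mul_nonneg (hp _) (sq_nonneg _)
  by_cases hS : ∑' i, p (i + m) = 0
  · have hz : ∀ l, p (l + m) = 0 := by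
      have := (hasSum_zero_iff_of_nonneg (fun l => hp (l + m))).1
        (hS ▸ ((summable_nat_add_iff m).2 hs.summable).hasSum)
      exact fun l => congrFun this l
    have h0 : ∑' l, p (l + m) * f l ^ 2 = 0 := by simp [hz]
    have h3 : ∑' r, p r * centred p m f r ^ 2 = 0 := le_antisymm (h0 ▸ hv)
      (tsum_nonneg fun l => mul_nonneg (hp _) (sq_nonneg _))
    rw [h0, h3, mul_zero, mul_zero]
  · have hSpos : 0 < ∑' i, p (i + m) :=
      lt_of_le_of_ne (tsum_nonneg fun i => hp _) (Ne.symm hS)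
    have := le_of_mul_le_mul_right (h.sum_measure_selected_mul_le hp hs m L N T) hSpos
    gcongr
    exact tsum_nonneg fun l => mul_nonneg (hp _) (sq_nonneg _)

/-- Uniformly over the ages `m < L`, weighted sums of squared deviations of the sample means from
the conditional means tend to zero almost surely. -/
lemma ae_tendsto_deviation (h : IsRenewalLaw p μ) (hp : ∀ k, 0 ≤ p k) (hs : HasSum p 1)
    {ι : Type*} [Countable ι] {w : ι → ℝ} (hw : ∀ i, 0 ≤ w i) {f : ι → ℕ → ℝ}
    (hf : ∀ i m, Summable fun l => p (l + m) * f i l ^ 2) {C : ℝ}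
    (hC : ∀ m, ∑' i, ENNReal.ofReal (w i * ∑' l, p (l + m) * f i l ^ 2) ≤ ENNReal.ofReal C)
    {N : ℕ → ℕ} (hN : Summable fun L : ℕ => (L : ℝ) ^ 2 / N L) :
    ∀ᵐ x ∂μ, Tendsto (fun L => ∑ m ∈ Finset.range L, ∑' i, ENNReal.ofReal (w i *
      deviation p x m L (N L) (f i) ^ 2)) atTop (𝓝 0) := by
  have hmain := fun i m L => h.integral_sq_selected_le hp hs (hf i m) L (N L) (2 ^ L)
  have hae : ∀ i m L, AEMeasurable (fun x => ENNReal.ofReal (w i *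
      deviation p x m L (N L) (f i) ^ 2)) μ := by
    intro i m L
    simp only [deviation, div_pow]
    exact (((hmain i m L).1.div_const _).const_mul
      _).aestronglyMeasurable.aemeasurable.ennreal_ofReal
  refine ae_tendsto_zero_of_tsum_lintegral
    (fun L => Finset.aemeasurable_fun_sum _ fun m _ => AEMeasurable.tsum fun i => hae i m L) ?_
  have hterm : ∀ i m L, ∫⁻ x, ENNReal.ofReal (w i *
      deviation p x m L (N L) (f i) ^ 2) ∂μ ≤
      ENNReal.ofReal (L / N L) * ENNReal.ofReal (w i * ∑' l, p (l + m) * f i l ^ 2) := by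
    intro i m L
    have hnn : 0 ≤ ∑' l, p (l + m) * f i l ^ 2 :=
      tsum_nonneg fun l => mul_nonneg (hp _) (sq_nonneg _)
    rw [← ofReal_integral_eq_lintegral_ofReal, integral_const_mul,
      ← ENNReal.ofReal_mul (by positivity)]
    · refine ENNReal.ofReal_le_ofReal ?_
      simp only [deviation, div_pow]
      rw [integral_div]
      have h1 := (hmain i m L).2
      have h2 : (∫ x, (∑ s ∈ Finset.range (2 ^ L), (selected m L (N L) s).indicator 1 x *
          centred p m (f i) (sigma x s)) ^ 2 ∂μ) / (N L : ℝ) ^ 2 ≤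
          (N L * L * ∑' l, p (l + m) * f i l ^ 2) / (N L : ℝ) ^ 2 := by gcongr
      refine (mul_le_mul_of_nonneg_left h2 (hw i)).trans (le_of_eq ?_)
      rcases Nat.eq_zero_or_pos (N L) with h0 | h0
      · simp [h0]
      · have : (N L : ℝ) ≠ 0 := by positivity
        field_simp
    · simp only [deviation, div_pow]
      exact ((hmain i m L).1.div_const _).const_mul _
    · exact ae_of_all _ fun x => mul_nonneg (hw i) (sq_nonneg _)
  have hL : ∀ L, ∫⁻ x, ∑ m ∈ Finset.range L, ∑' i, ENNReal.ofReal (w i *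
      deviation p x m L (N L) (f i) ^ 2) ∂μ ≤
      ENNReal.ofReal ((L : ℝ) ^ 2 / N L) * ENNReal.ofReal C := by
    intro L
    rw [lintegral_finsetSum' _ fun m _ => AEMeasurable.tsum fun i => hae i m L]
    calc ∑ m ∈ Finset.range L, ∫⁻ x, ∑' i, ENNReal.ofReal (w i *
          deviation p x m L (N L) (f i) ^ 2) ∂μ
        ≤ ∑ m ∈ Finset.range L, ENNReal.ofReal (L / N L) * ENNReal.ofReal C := by
          refine Finset.sum_le_sum fun m _ => ?_
          rw [lintegral_tsum fun i => hae i m L]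
          refine (ENNReal.tsum_le_tsum fun i => hterm i m L).trans ?_
          rw [ENNReal.tsum_mul_left]
          gcongr
          exact hC m
      _ = _ := by
          rw [Finset.sum_const, Finset.card_range, nsmul_eq_mul, ← mul_assoc,
            ← ENNReal.ofReal_natCast, ← ENNReal.ofReal_mul (by positivity)]
          congr 2
          ring
  refine ne_top_of_le_ne_top ?_ (ENNReal.tsum_le_tsum hL)
  rw [ENNReal.tsum_mul_right]
  exact ENNReal.mul_ne_top hN.tsum_ofReal_ne_top ENNReal.ofReal_ne_top

end IsRenewalLaw

/-! ### The density of the stopping times -/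

section Density

variable {x : ℕ → Fin 2} {p : ℕ → ℝ}

/-- Every time `t` with age at least `M` lies in a run of length at least `M`. -/
lemma card_age_le (hz : ∃ᶠ n in atTop, x n = 0) (M T : ℕ) :
    ((Finset.range T).filter (fun t => psi x ≤ t ∧ M ≤ tau x t)).card ≤
      ∑ s ∈ (Finset.range T).filter (fun s => x s = 0), (sigma x s + 1 - M) := by
  calc ((Finset.range T).filter (fun t => psi x ≤ t ∧ M ≤ tau x t)).card
      ≤ (((Finset.range T).filter (fun s => x s = 0)).sigma
          (fun s => Finset.Ico M (sigma x s + 1))).card := by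
        refine Finset.card_le_card_of_injOn (fun t => ⟨t - tau x t, tau x t⟩) (fun t ht => ?_) ?_
        · obtain ⟨h1, h2, h3⟩ := Finset.mem_filter.1 ht
          obtain ⟨k1, k2, k3⟩ := tau_zero hz h2
          have := Finset.mem_range.1 h1
          refine Finset.mem_coe.2 (Finset.mem_sigma.2 ⟨Finset.mem_filter.2 ⟨?_, k2⟩, ?_⟩)
          · exact Finset.mem_range.2 (lt_of_le_of_lt (Nat.sub_le _ _) this)
          · exact Finset.mem_Ico.2 ⟨h3, Nat.lt_succ_of_le k3⟩
        · intro a ha b hb hab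
          have ha' := (tau_zero hz (Finset.mem_filter.1 ha).2.1).1
          have hb' := (tau_zero hz (Finset.mem_filter.1 hb).2.1).1
          simp only [Sigma.mk.injEq, heq_eq_eq] at hab
          omega
    _ = _ := by simp [Finset.card_sigma]

/-- Up to a boundary term, every run of length at least `m` contributes one time of age `m`. -/
lemma card_runs_le (hz : ∃ᶠ n in atTop, x n = 0) (m L T : ℕ) :
    ((Finset.range T).filter (fun s => x s = 0 ∧ m ≤ sigma x s)).card ≤
      ((Finset.Ioo L T).filter (fun j => tau x j = m)).card + (L + 1 + m) := by
  have hsub : (Finset.range T).filter (fun s => x s = 0 ∧ m ≤ sigma x s) ⊆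
      ((Finset.range T).filter (fun s => (x s = 0 ∧ m ≤ sigma x s) ∧ s + m ∈ Finset.Ioo L T)) ∪
        (Finset.range (L + 1) ∪ Finset.Ico (T - m) T) := by
    intro s hs
    obtain ⟨h1, h2⟩ := Finset.mem_filter.1 hs
    simp only [Finset.mem_union, Finset.mem_filter, Finset.mem_range, Finset.mem_Ioo,
      Finset.mem_Ico] at *
    by_cases h3 : L < s + m ∧ s + m < T
    · exact Or.inl ⟨h1, h2, h3⟩
    · right; omega
  refine (Finset.card_le_card hsub).trans ((Finset.card_union_le _ _).trans ?_)
  refine add_le_add ?_ ((Finset.card_union_le _ _).trans ?_)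
  · refine Finset.card_le_card_of_injOn (fun s => s + m) (fun s hs => ?_)
      (fun a _ b _ hab => by simpa using hab)
    obtain ⟨-, ⟨h1, h2⟩, h3⟩ := Finset.mem_filter.1 hs
    exact Finset.mem_coe.2 (Finset.mem_filter.2 ⟨h3, tau_add hz h1 h2⟩)
  · rw [Finset.card_range, Nat.card_Ico]; omega

lemma RunAverages.eventually_abs_le {f : ℕ → ℝ} (h : RunAverages p f x) {ε : ℝ} (hε : 0 < ε) :
    ∀ᶠ L : ℕ in atTop,
      |∑ s ∈ (Finset.range (2 ^ L)).filter (fun s => x s = 0), f (sigma x s) -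
        (∑' k, p k * f k) * ((Finset.range (2 ^ L)).filter (fun s => x s = 0)).card| ≤
        ε * 2 ^ L := by
  have := (tendsto_zero_iff_abs_tendsto_zero _).1 h
  filter_upwards [this.eventually (gt_mem_nhds hε)] with L hL
  simp only [Function.comp_apply] at hL
  rw [abs_div, abs_of_pos (by positivity : (0 : ℝ) < 2 ^ L), div_lt_iff₀ (by positivity)] at hL
  exact hL.le

/-- The number of zeros before time `2 ^ L` grows linearly. -/
lemma eventually_le_card_zeros (hz : ∃ᶠ n in atTop, x n = 0)
    (h0 : RunAverages p (fun k => ((k + 1 - 0 : ℕ) : ℝ)) x) :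
    ∀ᶠ L : ℕ in atTop, (2 : ℝ) ^ L / 2 ≤ (∑' k, p k * ((k + 1 - 0 : ℕ) : ℝ)) *
      ((Finset.range (2 ^ L)).filter (fun s => x s = 0)).card := by
  have hpow : Tendsto (fun L : ℕ => (2 : ℝ) ^ L) atTop atTop :=
    tendsto_pow_atTop_atTop_of_one_lt one_lt_two
  filter_upwards [h0.eventually_abs_le (by norm_num : (0 : ℝ) < 1 / 4),
    hpow.eventually_ge_atTop (4 * psi x)] with L h1 h2
  have h3 := card_age_le hz 0 (2 ^ L)
  have h4 : 2 ^ L ≤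
      ((Finset.range (2 ^ L)).filter (fun t => psi x ≤ t ∧ 0 ≤ tau x t)).card + psi x := by
    have hsub : Finset.range (2 ^ L) ⊆
        (Finset.range (2 ^ L)).filter (fun t => psi x ≤ t ∧ 0 ≤ tau x t) ∪
          Finset.range (psi x) := by
      intro t ht
      simp only [Finset.mem_union, Finset.mem_filter, Finset.mem_range] at *
      omega
    have := (Finset.card_le_card hsub).trans (Finset.card_union_le _ _)
    rwa [Finset.card_range, Finset.card_range] at this
  have h5 : (2 : ℝ) ^ L ≤ ∑ s ∈ (Finset.range (2 ^ L)).filter (fun s => x s = 0),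
      ((sigma x s + 1 - 0 : ℕ) : ℝ) + psi x := by
    exact_mod_cast h4.trans (by gcongr)
  have := (abs_le.1 h1).2
  linarith

/-- Every age of positive probability eventually meets both stopping conditions. -/
lemma exists_stopAt_of_tau_eq (hz : ∃ᶠ n in atTop, x n = 0)
    (h0 : RunAverages p (fun k => ((k + 1 - 0 : ℕ) : ℝ)) x) (hp : Summable p) {m : ℕ}
    (hm : RunAverages p ((Set.Ici m).indicator 1) x) (hS : 0 < ∑' i, p (i + m)) {γ : ℝ}
    (hγ : 0 < γ) : ∃ L₀, ∀ t, L₀ ≤ Nat.log 2 t → tau x t = m → StopAt γ x t := by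
  set e := ∑' k, p k * ((k + 1 - 0 : ℕ) : ℝ) with he
  set S := ∑' i, p (i + m) with hSdef
  have hmean : ∑' k, p k * (Set.Ici m).indicator 1 k = S :=
    (hasSum_mul_indicator_Ici hp m).tsum_eq
  -- the number of zeros is nonnegative and at least `2 ^ L / (2 * e)`, so `e` is positive
  have hepos : 0 < e := by
    obtain ⟨L, hL⟩ := (eventually_le_card_zeros hz h0).exists
    by_contra hle
    have h1 : e * (((Finset.range (2 ^ L)).filter (fun s => x s = 0)).card : ℝ) ≤ 0 :=
      mul_nonpos_of_nonpos_of_nonneg (not_lt.1 hle) (Nat.cast_nonneg _)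
    have h2 : (0 : ℝ) < 2 ^ L := by positivity
    linarith
  set c := S / (2 * e) with hc
  have hcpos : 0 < c := by positivity
  have hruns : ∀ᶠ L : ℕ in atTop, c / 2 * 2 ^ L ≤
      (((Finset.range (2 ^ L)).filter (fun s => x s = 0 ∧ m ≤ sigma x s)).card : ℝ) := by
    filter_upwards [eventually_le_card_zeros hz h0,
      hm.eventually_abs_le (by positivity : 0 < c / 2)] with L h1 h2
    rw [hmean] at h2
    have h3 : ∑ s ∈ (Finset.range (2 ^ L)).filter (fun s => x s = 0),
        (Set.Ici m).indicator (1 : ℕ → ℝ) (sigma x s) =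
        ((Finset.range (2 ^ L)).filter (fun s => x s = 0 ∧ m ≤ sigma x s)).card := by
      rw [← Finset.filter_filter, Finset.card_eq_sum_ones, Finset.sum_filter (p := fun s => m ≤ _)]
      push_cast
      exact Finset.sum_congr rfl fun s _ => by simp [Set.indicator_apply]
    rw [h3] at h2
    have h4 := (abs_le.1 h2).1
    have h5 : c * 2 ^ L ≤ S * ((Finset.range (2 ^ L)).filter (fun s => x s = 0)).card := by
      have := mul_le_mul_of_nonneg_left h1 (by positivity : 0 ≤ S / e)
      calc c * 2 ^ L = S / e * (2 ^ L / 2) := by rw [hc]; field_simp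
        _ ≤ _ := this
        _ = _ := by rw [← he]; field_simp
    linarith
  -- pick one zero after `psi x` whose run reaches age `m`
  have hpow : Tendsto (fun L : ℕ => (2 : ℝ) ^ L) atTop atTop :=
    tendsto_pow_atTop_atTop_of_one_lt one_lt_two
  obtain ⟨z, hzpsi, hz0, hzm⟩ : ∃ z, psi x < z ∧ x z = 0 ∧ m ≤ sigma x z := by
    obtain ⟨L, h1, h2⟩ := (hruns.and ((hpow.const_mul_atTop (by positivity : 0 < c / 2)
      ).eventually_gt_atTop (psi x + 1 : ℝ))).exists
    by_contra! hcon
    have hsub : (Finset.range (2 ^ L)).filter (fun s => x s = 0 ∧ m ≤ sigma x s) ⊆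
        Finset.range (psi x + 1) := by
      intro s hs
      obtain ⟨-, h3, h4⟩ := Finset.mem_filter.1 hs
      by_contra hlt
      have := hcon s (by simp only [Finset.mem_range] at hlt; omega) h3
      omega
    have := Finset.card_le_card hsub
    rw [Finset.card_range] at this
    have : (((Finset.range (2 ^ L)).filter (fun s => x s = 0 ∧ m ≤ sigma x s)).card : ℝ) ≤
      psi x + 1 := by exact_mod_cast this
    linarith
  have hsmall1 : Tendsto (fun L : ℕ => ((L : ℝ) + 1 + m) / 2 ^ L) atTop (𝓝 0) := by
    have h1 := tendsto_pow_const_div_const_pow_of_one_lt 1 (one_lt_two : (1 : ℝ) < 2)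
    have h2 : Tendsto (fun L : ℕ => (1 + m : ℝ) / 2 ^ L) atTop (𝓝 0) := hpow.const_div_atTop _
    have := h1.add h2
    rw [add_zero] at this
    refine this.congr fun L => ?_
    rw [pow_one]; ring
  have hsmall2 : Tendsto (fun L : ℕ => ((2 : ℝ) ^ (-γ)) ^ L) atTop (𝓝 0) :=
    tendsto_pow_atTop_nhds_zero_of_lt_one (by positivity)
      (Real.rpow_lt_one_of_one_lt_of_neg one_lt_two (by linarith))
  obtain ⟨L₀, hL₀⟩ := eventually_atTop.1 (hruns.and
    (((hsmall1.eventually (gt_mem_nhds (by positivity : 0 < c / 4))).and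
      (hsmall2.eventually (gt_mem_nhds (by positivity : 0 < c / 4)))).and
      (eventually_gt_atTop (z + m))))
  refine ⟨L₀, fun t ht htau => ?_⟩
  set L := Nat.log 2 t
  obtain ⟨h1, ⟨h2, h3⟩, h4⟩ := hL₀ L ht
  refine ⟨⟨z + m, by omega, h4, by rw [htau, tau_add hz hz0 hzm]⟩, ?_⟩
  rw [htau]
  have h5 : (((Finset.range (2 ^ L)).filter (fun s => x s = 0 ∧ m ≤ sigma x s)).card : ℝ) ≤
      ((Finset.Ioo L (2 ^ L)).filter (fun j => tau x j = m)).card + (L + 1 + m) := by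
    exact_mod_cast card_runs_le hz m L (2 ^ L)
  have hpos : (0 : ℝ) < 2 ^ L := by positivity
  rw [div_lt_iff₀ hpos] at h2
  have h6 : (2 : ℝ) ^ ((L : ℝ) * (1 - γ)) = ((2 : ℝ) ^ (-γ)) ^ L * 2 ^ L := by
    rw [← Real.rpow_natCast, ← Real.rpow_mul two_pos.le, ← Real.rpow_natCast 2 L,
      ← Real.rpow_add two_pos]
    ring_nf
  have h7 := mul_lt_mul_of_pos_right h3 hpos
  rw [h6]
  linarith

open scoped Classical in
/-- The times at which the stopping condition fails have density zero. -/
lemma exists_card_not_stopAt_le (hz : ∃ᶠ n in atTop, x n = 0)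
    (hlin : ∀ M : ℕ, RunAverages p (fun k => ((k + 1 - M : ℕ) : ℝ)) x)
    (hind : ∀ m : ℕ, RunAverages p ((Set.Ici m).indicator 1) x) (hp : Summable p)
    (hS : ∀ t, psi x ≤ t → 0 < ∑' i, p (i + tau x t))
    (he : Tendsto (fun M : ℕ => ∑' k, p k * ((k + 1 - M : ℕ) : ℝ)) atTop (𝓝 0))
    {γ : ℝ} (hγ : 0 < γ) {ε : ℝ} (hε : 0 < ε) :
    ∃ C : ℝ, ∀ T : ℕ,
      (((Finset.range T).filter (fun t => psi x ≤ t ∧ ¬ StopAt γ x t)).card : ℝ) ≤ C + ε * T := by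
  obtain ⟨M, hM⟩ := (he.eventually (gt_mem_nhds (by positivity : 0 < ε / 4))).exists
  have hex : ∀ m, ∃ L₀, 0 < ∑' i, p (i + m) →
      ∀ t, L₀ ≤ Nat.log 2 t → tau x t = m → StopAt γ x t := by
    intro m
    by_cases h : 0 < ∑' i, p (i + m)
    · obtain ⟨L₀, h0⟩ := exists_stopAt_of_tau_eq hz (hlin 0) hp (hind m) h hγ
      exact ⟨L₀, fun _ => h0⟩
    · exact ⟨0, fun h' => absurd h' h⟩
  choose L₀ hL₀ using hex
  set L₁ := (Finset.range M).sup L₀ with hL₁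
  obtain ⟨L₂, hL₂⟩ := eventually_atTop.1 ((hlin M).eventually_abs_le (by positivity : 0 < ε / 4))
  refine ⟨2 ^ L₁ + 2 ^ L₂, fun T => ?_⟩
  have hsub : (Finset.range T).filter (fun t => psi x ≤ t ∧ ¬ StopAt γ x t) ⊆
      Finset.range (2 ^ L₁) ∪ (Finset.range T).filter (fun t => psi x ≤ t ∧ M ≤ tau x t) := by
    intro t ht
    obtain ⟨h1, h2, h3⟩ := Finset.mem_filter.1 ht
    by_contra hcon
    simp only [Finset.mem_union, Finset.mem_filter, Finset.mem_range, not_or, not_and,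
      not_le, not_lt] at hcon h1
    have hm := hcon.2 h1 h2
    refine h3 (hL₀ (tau x t) (hS t h2) t ?_ rfl)
    exact (Finset.le_sup (f := L₀) (Finset.mem_range.2 hm)).trans
      (Nat.le_log_of_pow_le one_lt_two hcon.1)
  have hcard := (Finset.card_le_card hsub).trans (Finset.card_union_le _ _)
  rw [Finset.card_range] at hcard
  have hage : (((Finset.range T).filter (fun t => psi x ≤ t ∧ M ≤ tau x t)).card : ℝ) ≤
      2 ^ L₂ + ε * T := by
    rcases le_or_gt T (2 ^ L₂) with hT | hT
    · have h1 := (Finset.card_filter_le (Finset.range T)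
        (fun t => psi x ≤ t ∧ M ≤ tau x t)).trans_eq (Finset.card_range T)
      have h2 : (((Finset.range T).filter (fun t => psi x ≤ t ∧ M ≤ tau x t)).card : ℝ) ≤
        2 ^ L₂ := by exact_mod_cast h1.trans hT
      have : 0 ≤ ε * T := by positivity
      linarith
    · -- compare with the next power of two
      have hT0 : T ≠ 0 := by rintro rfl; simp at hT
      set L := Nat.log 2 T + 1 with hL
      have h1 : T ≤ 2 ^ L := (Nat.lt_pow_succ_log_self one_lt_two T).le
      have h2 : L₂ ≤ L := (Nat.le_log_of_pow_le one_lt_two hT.le).trans (Nat.le_succ _)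
      have h3 : 2 ^ L ≤ 2 * T := by
        rw [hL, pow_succ, mul_comm]
        exact Nat.mul_le_mul_left 2 (Nat.pow_log_le_self 2 hT0)
      have h4 : ((Finset.range T).filter (fun t => psi x ≤ t ∧ M ≤ tau x t)).card ≤
          ((Finset.range (2 ^ L)).filter (fun t => psi x ≤ t ∧ M ≤ tau x t)).card :=
        Finset.card_le_card (Finset.filter_subset_filter _ (Finset.range_mono h1))
      have h5 : (((Finset.range T).filter (fun t => psi x ≤ t ∧ M ≤ tau x t)).card : ℝ) ≤
          ∑ s ∈ (Finset.range (2 ^ L)).filter (fun s => x s = 0), ((sigma x s + 1 - M : ℕ) : ℝ) := by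
        exact_mod_cast h4.trans (card_age_le hz M (2 ^ L))
      have h6 := (abs_le.1 (hL₂ L h2)).2
      have h7 : (((Finset.range (2 ^ L)).filter (fun s => x s = 0)).card : ℝ) ≤ 2 ^ L := by
        exact_mod_cast (Finset.card_filter_le _ _).trans_eq (Finset.card_range _)
      have h8 : (∑' k, p k * ((k + 1 - M : ℕ) : ℝ)) *
          ((Finset.range (2 ^ L)).filter (fun s => x s = 0)).card ≤ ε / 4 * 2 ^ L :=
        mul_le_mul hM.le h7 (Nat.cast_nonneg _) (by positivity)
      have h9 : (2 : ℝ) ^ L ≤ 2 * T := by exact_mod_cast h3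
      have h10 : (0 : ℝ) ≤ 2 ^ L₂ := by positivity
      have h11 := mul_le_mul_of_nonneg_left h9 hε.le
      linarith
  have : (((Finset.range T).filter (fun t => psi x ≤ t ∧ ¬ StopAt γ x t)).card : ℝ) ≤
      2 ^ L₁ + ((Finset.range T).filter (fun t => psi x ≤ t ∧ M ≤ tau x t)).card := by
    exact_mod_cast hcard
  linarith

end Density

section Lambda

variable {x : ℕ → Fin 2} {γ : ℝ}

lemma lambdaStar_succ_spec (hinf : ∀ a, ∃ t, a < t ∧ StopAt γ x t) (n : ℕ) :
    lambdaStar γ x n < lambdaStar γ x (n + 1) ∧ StopAt γ x (lambdaStar γ x (n + 1)) :=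
  Nat.sInf_mem (s := {t | lambdaStar γ x n < t ∧ StopAt γ x t}) (hinf _)

lemma le_lambdaStar (hinf : ∀ a, ∃ t, a < t ∧ StopAt γ x t) (n : ℕ) : n ≤ lambdaStar γ x n :=
  (strictMono_nat_of_lt_succ fun n => (lambdaStar_succ_spec hinf n).1).le_apply

lemma psi_le_lambdaStar (hinf : ∀ a, ∃ t, a < t ∧ StopAt γ x t) (n : ℕ) :
    psi x ≤ lambdaStar γ x n :=
  (strictMono_nat_of_lt_succ fun n => (lambdaStar_succ_spec hinf n).1).monotone (Nat.zero_le n)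

open scoped Classical in
/-- The stopping times exhaust the times at which the stopping condition holds. -/
lemma card_stopAt_le (n : ℕ) :
    ((Finset.Ioc (psi x) (lambdaStar γ x n)).filter (fun t => StopAt γ x t)).card ≤ n := by
  induction n with
  | zero => simp [lambdaStar]
  | succ n ih =>
    have hsub : (Finset.Ioc (psi x) (lambdaStar γ x (n + 1))).filter (fun t => StopAt γ x t) ⊆
        insert (lambdaStar γ x (n + 1))
          ((Finset.Ioc (psi x) (lambdaStar γ x n)).filter (fun t => StopAt γ x t)) := by
      intro t ht
      obtain ⟨h1, h2⟩ := Finset.mem_filter.1 ht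
      obtain ⟨h3, h4⟩ := Finset.mem_Ioc.1 h1
      by_cases h5 : t ≤ lambdaStar γ x n
      · exact Finset.mem_insert_of_mem (Finset.mem_filter.2 ⟨Finset.mem_Ioc.2 ⟨h3, h5⟩, h2⟩)
      · have : lambdaStar γ x (n + 1) ≤ t :=
          Nat.sInf_le (s := {t | lambdaStar γ x n < t ∧ StopAt γ x t}) ⟨not_le.1 h5, h2⟩
        exact Finset.mem_insert.2 (Or.inl (le_antisymm h4 this))
    exact (Finset.card_le_card hsub).trans ((Finset.card_insert_le _ _).trans (by omega))

open scoped Classical in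
/-- If the stopping condition fails only on a set of times of density zero, there are infinitely
many stopping times and `lambdaStar n ∼ n`. -/
lemma tendsto_lambdaStar_div
    (hbad : ∀ ε : ℝ, 0 < ε → ∃ C : ℝ, ∀ T : ℕ,
      (((Finset.range T).filter (fun t => psi x ≤ t ∧ ¬ StopAt γ x t)).card : ℝ) ≤ C + ε * T) :
    (∀ a, ∃ t, a < t ∧ StopAt γ x t) ∧
    Tendsto (fun n : ℕ => (lambdaStar γ x n : ℝ) / (n : ℝ)) atTop (𝓝 1) := by
  have hinf : ∀ a, ∃ t, a < t ∧ StopAt γ x t := by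
    intro a
    by_contra! hcon
    obtain ⟨C, hC⟩ := hbad (1 / 2) (by norm_num)
    obtain ⟨T, hT⟩ := exists_nat_gt (2 * (C + (psi x + a + 1)))
    have hsub : Finset.range T ⊆
        (Finset.range T).filter (fun t => psi x ≤ t ∧ ¬ StopAt γ x t) ∪
          Finset.range (psi x + a + 1) := by
      intro t ht
      simp only [Finset.mem_union, Finset.mem_filter, Finset.mem_range] at *
      by_cases h : t < psi x + a + 1
      · exact Or.inr h
      · exact Or.inl ⟨ht, by omega, hcon t (by omega)⟩
    have h1 := (Finset.card_le_card hsub).trans (Finset.card_union_le _ _)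
    rw [Finset.card_range, Finset.card_range] at h1
    have h2 : (T : ℝ) ≤ ((Finset.range T).filter (fun t => psi x ≤ t ∧ ¬ StopAt γ x t)).card +
      (psi x + a + 1) := by exact_mod_cast h1
    have h3 := hC T
    linarith
  refine ⟨hinf, ?_⟩
  have hupper : ∀ ε : ℝ, 0 < ε → ∃ C : ℝ, ∀ n : ℕ,
      (lambdaStar γ x n : ℝ) ≤ n + C + ε * lambdaStar γ x n := by
    intro ε hε
    obtain ⟨C, hC⟩ := hbad ε hε
    refine ⟨C + psi x + ε, fun n => ?_⟩
    have h1 := card_stopAt_le (x := x) (γ := γ) n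
    have hsub : Finset.Ioc (psi x) (lambdaStar γ x n) ⊆
        (Finset.Ioc (psi x) (lambdaStar γ x n)).filter (fun t => StopAt γ x t) ∪
        (Finset.range (lambdaStar γ x n + 1)).filter (fun t => psi x ≤ t ∧ ¬ StopAt γ x t) := by
      intro t ht
      simp only [Finset.mem_union, Finset.mem_filter, Finset.mem_range]
      have := Finset.mem_Ioc.1 ht
      by_cases h : StopAt γ x t
      · exact Or.inl ⟨ht, h⟩
      · exact Or.inr ⟨by omega, by omega, h⟩
    have h2 := (Finset.card_le_card hsub).trans (Finset.card_union_le _ _)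
    rw [Nat.card_Ioc] at h2
    have h3 : lambdaStar γ x n ≤ n + ((Finset.range (lambdaStar γ x n + 1)).filter
        (fun t => psi x ≤ t ∧ ¬ StopAt γ x t)).card + psi x := by omega
    have h4 : (lambdaStar γ x n : ℝ) ≤ n + ((Finset.range (lambdaStar γ x n + 1)).filter
        (fun t => psi x ≤ t ∧ ¬ StopAt γ x t)).card + psi x := by exact_mod_cast h3
    have h5 := hC (lambdaStar γ x n + 1)
    push_cast at h5
    linarith
  rw [Metric.tendsto_atTop]
  intro δ hδ
  -- this choice gives `(1 - ε) * (1 + δ / 2) = 1 + δ / 4`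
  set ε := δ / (4 * (1 + δ / 2)) with hε
  have hε0 : 0 < ε := by positivity
  have hεδ : (1 - ε) * (1 + δ / 2) = 1 + δ / 4 := by rw [hε]; field_simp; ring
  obtain ⟨C, hC⟩ := hupper ε hε0
  obtain ⟨n₀, hn₀⟩ := exists_nat_gt (4 * C / δ)
  refine ⟨n₀ + 1, fun n hn => ?_⟩
  have hnpos : (0 : ℝ) < n := by
    have : 0 < n := by omega
    exact_mod_cast this
  have h1 : (n : ℝ) ≤ lambdaStar γ x n := by exact_mod_cast le_lambdaStar hinf n
  have h2 := hC n
  have h3 : C ≤ δ / 4 * n := by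
    have : (n₀ : ℝ) ≤ n := by exact_mod_cast (by omega : n₀ ≤ n)
    rw [div_lt_iff₀ hδ] at hn₀
    nlinarith
  have hlt : 0 < 1 - ε := by
    by_contra hcon
    have : (1 - ε) * (1 + δ / 2) ≤ 0 :=
      mul_nonpos_of_nonpos_of_nonneg (not_lt.1 hcon) (by positivity)
    rw [hεδ] at this
    linarith
  have h4 : (lambdaStar γ x n : ℝ) ≤ (1 + δ / 2) * n := by
    refine le_of_mul_le_mul_left ?_ hlt
    rw [← mul_assoc, hεδ]
    linarith
  rw [Real.dist_eq, abs_lt, lt_sub_iff_add_lt, sub_lt_iff_lt_add, lt_div_iff₀ hnpos,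
    div_lt_iff₀ hnpos]
  constructor
  · nlinarith
  · nlinarith

end Lambda

/-! ### The estimators as sums over sampled runs -/

section Estimators

variable {x : ℕ → Fin 2} {p : ℕ → ℝ} {γ : ℝ}

/-- The index at which the `N`-th occurrence is found exists as soon as there are `N`
occurrences. -/
lemma sInf_card_eq_spec (q : ℕ → Prop) [DecidablePred q] {L N K : ℕ}
    (h : N ≤ ((Finset.Ioo L K).filter q).card) (hN : 0 < N) :
    sInf {k | ((Finset.Ioc L k).filter q).card = N} < K ∧
      ((Finset.Ioc L (sInf {k | ((Finset.Ioc L k).filter q).card = N})).filter q).card = N := by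
  have hKpos : 0 < K := by
    rcases Nat.eq_zero_or_pos K with rfl | h0
    · simp at h; omega
    · exact h0
  have hIoo : Finset.Ioo L K = Finset.Ioc L (K - 1) := by
    ext j; simp only [Finset.mem_Ioo, Finset.mem_Ioc]; omega
  rw [hIoo] at h
  have hex : ∃ k, N ≤ ((Finset.Ioc L k).filter q).card := ⟨K - 1, h⟩
  set k := Nat.find hex with hk
  have hk1 : N ≤ ((Finset.Ioc L k).filter q).card := Nat.find_spec hex
  have hkle : k ≤ K - 1 := Nat.find_min' hex h
  have hkpos : k ≠ 0 := by
    intro h0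
    rw [h0] at hk1
    simp at hk1; omega
  have hk2 : ((Finset.Ioc L (k - 1)).filter q).card < N :=
    not_le.1 (Nat.find_min hex (m := k - 1) (by omega))
  have hsub : (Finset.Ioc L k).filter q ⊆ insert k ((Finset.Ioc L (k - 1)).filter q) := by
    intro j hj
    simp only [Finset.mem_filter, Finset.mem_Ioc, Finset.mem_insert] at hj ⊢
    by_cases hjk : j = k
    · exact Or.inl hjk
    · exact Or.inr ⟨⟨hj.1.1, by omega⟩, hj.2⟩
  have hk3 := (Finset.card_le_card hsub).trans (Finset.card_insert_le _ _)
  have hmem : k ∈ {k | ((Finset.Ioc L k).filter q).card = N} := by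
    change _ = _; omega
  exact ⟨by have := Nat.sInf_le hmem; omega, Nat.sInf_mem ⟨k, hmem⟩⟩

/-- The occurrences of age `m` in `(L, κ]` are the times at which the selected runs reach
age `m`. -/
lemma sum_selected_eq (hz : ∃ᶠ n in atTop, x n = 0) {m L N κ T : ℕ}
    (hi : ∃ i, psi x < i ∧ i < L ∧ tau x i = m) (hκ : κ < T)
    (hN : ((Finset.Ioc L κ).filter (fun j => tau x j = m)).card = N) (F : ℕ → ℝ) :
    ∑ s ∈ Finset.range T, (selected m L N s).indicator (1 : (ℕ → Fin 2) → ℝ) x *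
        (if m ≤ sigma x s then F (sigma x s - m) else 0) =
      ∑ j ∈ (Finset.Ioc L κ).filter (fun j => tau x j = m), F (sigma x j) := by
  classical
  obtain ⟨i, hi1, hi2, hi3⟩ := hi
  have hl : ∀ s, (selected m L N s).indicator (1 : (ℕ → Fin 2) → ℝ) x *
        (if m ≤ sigma x s then F (sigma x s - m) else 0) =
      if x ∈ selected m L N s ∧ m ≤ sigma x s then F (sigma x s - m) else 0 := by
    intro s
    by_cases h1 : x ∈ selected m L N s <;> by_cases h2 : m ≤ sigma x s <;> simp [h1, h2]
  rw [Finset.sum_congr rfl fun s _ => hl s, ← Finset.sum_filter]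
  refine Finset.sum_bij' (fun s _ => s + m) (fun j _ => j - m) ?_ ?_ ?_ ?_ ?_
  · intro s hs
    obtain ⟨-, ⟨h0, h1, -, h2⟩, h3⟩ := Finset.mem_filter.1 hs
    refine Finset.mem_filter.2 ⟨Finset.mem_Ioc.2 ⟨h1, ?_⟩, tau_add hz h0 h3⟩
    by_contra hlt
    -- otherwise all `N` occurrences up to `κ` would precede this one
    have hsub : (Finset.Ioc L κ).filter (fun j => tau x j = m) ⊆
        (Finset.Ioo L s).filter (fun j => tau x j = m) := by
      intro j hj
      obtain ⟨k1, k2⟩ := Finset.mem_filter.1 hj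
      obtain ⟨k3, k4⟩ := Finset.mem_Ioc.1 k1
      exact Finset.mem_filter.2 ⟨Finset.mem_Ioo.2
        ⟨k3, lt_of_tau_eq hz (by omega) h0 k2 (by omega)⟩, k2⟩
    have := Finset.card_le_card hsub
    omega
  · intro j hj
    obtain ⟨k1, k2⟩ := Finset.mem_filter.1 hj
    obtain ⟨k3, k4⟩ := Finset.mem_Ioc.1 k1
    obtain ⟨t1, t2, t3⟩ := tau_zero hz (by omega : psi x ≤ j)
    rw [k2] at t1 t2 t3
    refine Finset.mem_filter.2 ⟨Finset.mem_range.2 (by omega), ⟨t2, by omega, ⟨i, hi1, hi2, ?_, hi3⟩,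
      ?_⟩, t3⟩
    · exact lt_of_tau_eq hz hi1.le t2 hi3 (by omega)
    · rw [← hN]
      refine Finset.card_lt_card ((Finset.ssubset_iff_of_subset ?_).2 ⟨j, hj, ?_⟩)
      · refine Finset.filter_subset_filter _ fun a ha => ?_
        simp only [Finset.mem_Ioo, Finset.mem_Ioc] at ha ⊢
        omega
      · simp only [Finset.mem_filter, Finset.mem_Ioo]
        omega
  · intro s _
    simp
  · intro j hj
    obtain ⟨k1, k2⟩ := Finset.mem_filter.1 hj
    obtain ⟨k3, k4⟩ := Finset.mem_Ioc.1 k1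
    have t1 := (tau_zero hz (by omega : psi x ≤ j)).1
    change j - m + m = j
    omega
  · intro s hs
    obtain ⟨-, -, h3⟩ := Finset.mem_filter.1 hs
    rw [sigma_add hz h3]

lemma sampleSize_pos (γ : ℝ) (t : ℕ) : 0 < sampleSize γ t :=
  Nat.ceil_pos.2 (by positivity)

/-- The deviation of a sample mean from the conditional mean is the centred sum over the
selected runs. -/
lemma deviation_eq (hz : ∃ᶠ n in atTop, x n = 0) {n : ℕ}
    (hSt : StopAt γ x (lambdaStar γ x n)) (f : ℕ → ℝ) :
    deviation p x (tau x (lambdaStar γ x n)) (Nat.log 2 (lambdaStar γ x n))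
      (sampleSize γ (lambdaStar γ x n)) f =
    1 / (sampleSize γ (lambdaStar γ x n) : ℝ) *
      (∑ i ∈ Finset.Icc (Nat.log 2 (lambdaStar γ x n) + 1) (kappaStar γ x n),
        if tau x i = tau x (lambdaStar γ x n) then f (sigma x i) else 0) -
      residualMean p (tau x (lambdaStar γ x n)) f := by
  obtain ⟨⟨i, hi1, hi2, hi3⟩, hcard⟩ := hSt
  set t := lambdaStar γ x n
  set L := Nat.log 2 t
  set m := tau x t
  set N := sampleSize γ t with hNdef
  have hNpos : 0 < N := sampleSize_pos γ t
  have hNle : N ≤ ((Finset.Ioo L (2 ^ L)).filter (fun j => tau x j = m)).card :=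
    Nat.ceil_le.2 hcard
  obtain ⟨hκ1, hκ2⟩ := sInf_card_eq_spec (fun j => tau x j = m) hNle hNpos
  change kappaStar γ x n < _ at hκ1
  change ((Finset.Ioc L (kappaStar γ x n)).filter _).card = _ at hκ2
  have h1 := sum_selected_eq hz ⟨i, hi1, hi2, hi3⟩ hκ1 hκ2 (fun l => f l - residualMean p m f)
  simp only [deviation, centred]
  rw [h1, Finset.sum_sub_distrib, Finset.sum_const, hκ2, nsmul_eq_mul, Finset.sum_filter]
  have hIcc : Finset.Icc (L + 1) (kappaStar γ x n) = Finset.Ioc L (kappaStar γ x n) := by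
    ext j; simp only [Finset.mem_Icc, Finset.mem_Ioc]; omega
  rw [hIcc]
  have : (N : ℝ) ≠ 0 := by positivity
  field_simp

lemma hStar_sub_residualMean (hz : ∃ᶠ n in atTop, x n = 0) {n : ℕ}
    (hSt : StopAt γ x (lambdaStar γ x n)) :
    hStar γ x n - residualMean p (tau x (lambdaStar γ x n)) (fun l => l) =
      deviation p x (tau x (lambdaStar γ x n)) (Nat.log 2 (lambdaStar γ x n))
        (sampleSize γ (lambdaStar γ x n)) (fun l => l) :=
  (deviation_eq hz hSt _).symm

lemma pStar_sub_div (hz : ∃ᶠ n in atTop, x n = 0) {n : ℕ}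
    (hSt : StopAt γ x (lambdaStar γ x n)) (l : ℕ) :
    pStar γ x n l - p (l + tau x (lambdaStar γ x n)) /
        ∑' i : ℕ, p (i + tau x (lambdaStar γ x n)) =
      deviation p x (tau x (lambdaStar γ x n)) (Nat.log 2 (lambdaStar γ x n))
        (sampleSize γ (lambdaStar γ x n)) (fun k => if k = l then 1 else 0) := by
  rw [deviation_eq hz hSt, pStar]
  simp only [← ite_and]
  have h : residualMean p (tau x (lambdaStar γ x n)) (fun k => if k = l then (1 : ℝ) else 0) =
      p (l + tau x (lambdaStar γ x n)) / ∑' i : ℕ, p (i + tau x (lambdaStar γ x n)) := by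
    simp [residualMean]
  rw [h]

lemma tendsto_of_tendsto_sum_range {G : ℕ → ℕ → ENNReal}
    (hG : Tendsto (fun L => ∑ m ∈ Finset.range L, G m L) atTop (𝓝 0)) {a b : ℕ → ℕ}
    (hb : Tendsto b atTop atTop) (hab : ∀ᶠ n in atTop, a n < b n) :
    Tendsto (fun n => G (a n) (b n)) atTop (𝓝 0) := by
  refine tendsto_of_tendsto_of_tendsto_of_le_of_le' tendsto_const_nhds (hG.comp hb)
    (Eventually.of_forall fun _ => zero_le) ?_
  filter_upwards [hab] with n hn
  exact Finset.single_le_sum (f := fun m => G m (b n)) (fun _ _ => zero_le)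
    (Finset.mem_range.2 hn)

/-- Cauchy-Schwarz for an absolutely convergent series with weights `(l + 1) ^ 2`, in the form
given by the inequality of arithmetic and geometric means. -/
lemma tsum_abs_le {d : ℕ → ℝ} {δ : ℝ} (hδ : 0 < δ)
    (h : ∑' l : ℕ, ENNReal.ofReal (((l : ℝ) + 1) ^ 2 * d l ^ 2) ≤ ENNReal.ofReal (δ ^ 2)) :
    ∑' l, |d l| ≤ δ * (∑' l : ℕ, 1 / ((l : ℝ) + 1) ^ 2 + 1) := by
  set w : ℕ → ℝ := fun l => ((l : ℝ) + 1) ^ 2 * d l ^ 2 with hw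
  have hwnn : ∀ l, 0 ≤ w l := fun l => by positivity
  have hws : Summable w := by
    have := ENNReal.summable_toReal (ne_top_of_le_ne_top ENNReal.ofReal_ne_top h)
    exact this.congr fun l => ENNReal.toReal_ofReal (hwnn l)
  have hwle : ∑' l, w l ≤ δ ^ 2 := by
    rw [← ENNReal.ofReal_tsum_of_nonneg hwnn hws] at h
    exact (ENNReal.ofReal_le_ofReal_iff (by positivity)).1 h
  have hzs : Summable fun l : ℕ => 1 / ((l : ℝ) + 1) ^ 2 := by
    have := (summable_nat_add_iff 1).2 (Real.summable_one_div_nat_pow.2 one_lt_two)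
    simpa using this
  have hterm : ∀ l, |d l| ≤ δ * (1 / ((l : ℝ) + 1) ^ 2) + 1 / δ * w l := by
    intro l
    have ha : (0 : ℝ) < (l : ℝ) + 1 := by positivity
    have h1 : δ * (1 / ((l : ℝ) + 1) ^ 2) + 1 / δ * w l - |d l| =
        ((δ - ((l : ℝ) + 1) ^ 2 * |d l| / 2) ^ 2 + 3 / 4 * (((l : ℝ) + 1) ^ 2 * |d l|) ^ 2) /
          (δ * ((l : ℝ) + 1) ^ 2) := by
      simp only [hw]
      rw [← sq_abs (d l)]
      field_simp
      ring
    have h2 : 0 ≤ ((δ - ((l : ℝ) + 1) ^ 2 * |d l| / 2) ^ 2 +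
        3 / 4 * (((l : ℝ) + 1) ^ 2 * |d l|) ^ 2) / (δ * ((l : ℝ) + 1) ^ 2) := by positivity
    linarith
  have hs := (hzs.mul_left δ).add (hws.mul_left (1 / δ))
  calc ∑' l, |d l| ≤ ∑' l : ℕ, (δ * (1 / ((l : ℝ) + 1) ^ 2) + 1 / δ * w l) :=
        (hs.of_nonneg_of_le (fun l => abs_nonneg _) hterm).tsum_le_tsum hterm hs
    _ = δ * (∑' l : ℕ, 1 / ((l : ℝ) + 1) ^ 2) + 1 / δ * ∑' l, w l := by
        rw [(hzs.mul_left δ).tsum_add (hws.mul_left (1 / δ)), tsum_mul_left, tsum_mul_left]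
    _ ≤ δ * (∑' l : ℕ, 1 / ((l : ℝ) + 1) ^ 2) + 1 / δ * δ ^ 2 := by gcongr
    _ = _ := by field_simp

end Estimators

/-! ### Almost sure convergence under the renewal property -/

section Limits

variable {p : ℕ → ℝ} {μ : Measure (ℕ → Fin 2)} {γ : ℝ}

lemma summable_sq_div_sampleSize (hγ : γ < 1) :
    Summable fun L : ℕ => (L : ℝ) ^ 2 / (⌈(2 : ℝ) ^ ((L : ℝ) * (1 - γ))⌉₊ : ℝ) := by
  have hr : ‖(2 : ℝ) ^ (-(1 - γ))‖ < 1 := by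
    rw [Real.norm_eq_abs, abs_of_pos (by positivity)]
    exact Real.rpow_lt_one_of_one_lt_of_neg one_lt_two (by linarith)
  refine (summable_pow_mul_geometric_of_norm_lt_one 2 hr).of_nonneg_of_le
    (fun L => by positivity) fun L => ?_
  have h1 : ((2 : ℝ) ^ (-(1 - γ))) ^ L = ((2 : ℝ) ^ ((L : ℝ) * (1 - γ)))⁻¹ := by
    rw [← Real.rpow_natCast, ← Real.rpow_mul two_pos.le, ← Real.rpow_neg two_pos.le]
    ring_nf
  rw [h1, ← div_eq_mul_inv]
  gcongr
  exact Nat.le_ceil _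

lemma summable_succ_sq_mul (hs : Summable p) (hp : ∀ k, 0 ≤ p k) {α : ℝ} (hα : 1 < α)
    (hm : Summable fun k : ℕ => (k : ℝ) ^ (α + 1) * p k) :
    Summable fun k : ℕ => p k * ((k : ℝ) + 1) ^ 2 := by
  refine ((hs.mul_left 2).add (hm.mul_left 2)).of_nonneg_of_le
    (fun k => mul_nonneg (hp k) (by positivity)) fun k => ?_
  have h1 : (k : ℝ) ^ 2 ≤ (k : ℝ) ^ (α + 1) := by
    rcases Nat.eq_zero_or_pos k with rfl | hk
    · simp [Real.zero_rpow (by linarith : α + 1 ≠ 0)]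
    · rw [← Real.rpow_two]
      exact Real.rpow_le_rpow_of_exponent_le (by exact_mod_cast hk) (by linarith)
  have h2 := mul_le_mul_of_nonneg_left h1 (hp k)
  nlinarith [mul_nonneg (hp k) (sq_nonneg ((k : ℝ) - 1))]

/-- The mean excess of a run length over `M` tends to zero. -/
lemma tendsto_tsum_excess (hp : ∀ k, 0 ≤ p k)
    (hsq : Summable fun k : ℕ => p k * ((k : ℝ) + 1) ^ 2) :
    Tendsto (fun M : ℕ => ∑' k, p k * ((k + 1 - M : ℕ) : ℝ)) atTop (𝓝 0) := by
  have h := tendsto_tsum_of_dominated_convergence (𝓕 := atTop)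
    (f := fun (M : ℕ) (k : ℕ) => p k * ((k + 1 - M : ℕ) : ℝ)) (g := fun _ => (0 : ℝ)) hsq
    (fun k => ?_) (Eventually.of_forall fun M k => ?_)
  · simpa using h
  · refine tendsto_const_nhds.congr' ?_
    filter_upwards [eventually_ge_atTop (k + 1)] with M hM
    simp [Nat.sub_eq_zero_of_le hM]
  · rw [Real.norm_of_nonneg (mul_nonneg (hp k) (Nat.cast_nonneg _))]
    have h1 : ((k + 1 - M : ℕ) : ℝ) ≤ (k : ℝ) + 1 := by exact_mod_cast Nat.sub_le _ _
    have := hp k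
    gcongr
    nlinarith [Nat.cast_nonneg (α := ℝ) k]

namespace IsRenewalLaw

/-- Ages of probability zero do not occur. -/
lemma ae_tail_pos (h : IsRenewalLaw p μ) (hp : ∀ k, 0 ≤ p k) (hs : HasSum p 1) :
    ∀ᵐ x ∂μ, ∀ t, psi x ≤ t → 0 < ∑' i, p (i + tau x t) := by
  have := h.isProbabilityMeasure
  have hzero : ∀ᵐ x ∂μ, ∀ s m, ∑' i, p (i + m) = 0 → ¬ (x s = 0 ∧ m ≤ sigma x s) := by
    refine ae_all_iff.2 fun s => ae_all_iff.2 fun m => ?_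
    by_cases hm : ∑' i, p (i + m) = 0
    · obtain ⟨h1, h2⟩ := h.integral_indicator_runs hp hs (H := {x | x s = 0}) (s := s)
        (fun x y hxy => by simp only [Set.mem_ofPred_eq, hxy s (Set.mem_Iic.2 le_rfl)])
        (fun x hx => hx) m
      have hnn : 0 ≤ fun x : ℕ → Fin 2 => ({x : ℕ → Fin 2 | x s = 0}.indicator 1 x *
          (Set.Ici m).indicator 1 (sigma x s) : ℝ) := fun x =>
        mul_nonneg (Set.indicator_nonneg (fun _ _ => zero_le_one) _)
          (Set.indicator_nonneg (fun _ _ => zero_le_one) _)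
      rw [hm, mul_zero, integral_eq_zero_iff_of_nonneg hnn h1] at h2
      filter_upwards [h2] with x hx _ hcon
      simp [hcon.1, hcon.2] at hx
    · exact ae_of_all _ fun x h0 => absurd h0 hm
  filter_upwards [hzero, h.frequently_zero] with x hx hz t ht
  obtain ⟨-, h2, h3⟩ := tau_zero hz ht
  exact lt_of_le_of_ne (tsum_nonneg fun i => hp _) fun h0 => hx _ _ h0.symm ⟨h2, h3⟩

/-- The three limits along almost every path, with the conditional expectation replaced by the
mean residual waiting time at the current age. -/
lemma ae_limits (h : IsRenewalLaw p μ) (hp : ∀ k, 0 ≤ p k) (hs : HasSum p 1)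
    (hsq : Summable fun k : ℕ => p k * ((k : ℝ) + 1) ^ 2) (hγ0 : 0 < γ) (hγ1 : γ < 1) :
    ∀ᵐ x ∂μ, (∀ n, psi x ≤ lambdaStar γ x n) ∧
      Tendsto (fun n : ℕ => (lambdaStar γ x n : ℝ) / (n : ℝ)) atTop (𝓝 1) ∧
      Tendsto (fun n : ℕ => |hStar γ x n -
        residualMean p (tau x (lambdaStar γ x n)) (fun l => l)|) atTop (𝓝 0) ∧
      Tendsto (fun n : ℕ => ∑' l : ℕ, |pStar γ x n l - p (l + tau x (lambdaStar γ x n)) /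
        ∑' i : ℕ, p (i + tau x (lambdaStar γ x n))|) atTop (𝓝 0) := by
  set N : ℕ → ℕ := fun L => ⌈(2 : ℝ) ^ ((L : ℝ) * (1 - γ))⌉₊ with hN
  have hNs := summable_sq_div_sampleSize hγ1
  set C := ∑' k : ℕ, p k * ((k : ℝ) + 1) ^ 2
  have hshift : ∀ m, Summable fun l : ℕ => p (l + m) * ((l : ℝ) + 1) ^ 2 := by
    intro m
    refine ((summable_nat_add_iff m).2 hsq).of_nonneg_of_le
      (fun l => mul_nonneg (hp _) (by positivity)) fun l => ?_
    have := hp (l + m)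
    gcongr
    simp
  have hshiftC : ∀ m, ∑' l : ℕ, p (l + m) * ((l : ℝ) + 1) ^ 2 ≤ C := by
    intro m
    calc ∑' l : ℕ, p (l + m) * ((l : ℝ) + 1) ^ 2
        ≤ ∑' l : ℕ, p (l + m) * (((l + m : ℕ) : ℝ) + 1) ^ 2 := by
          refine (hshift m).tsum_le_tsum (fun l => ?_) ((summable_nat_add_iff m).2 hsq)
          have := hp (l + m)
          gcongr
          simp
      _ ≤ C := by
          change _ ≤ ∑' k : ℕ, p k * ((k : ℝ) + 1) ^ 2
          rw [← hsq.sum_add_tsum_nat_add m]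
          refine le_add_of_nonneg_left (Finset.sum_nonneg fun k _ => ?_)
          exact mul_nonneg (hp k) (by positivity)
  -- the estimator of the mean
  have hidle : ∀ m l : ℕ, p (l + m) * (l : ℝ) ^ 2 ≤ p (l + m) * ((l : ℝ) + 1) ^ 2 := by
    intro m l
    have := hp (l + m)
    gcongr
    linarith
  have hids : ∀ m, Summable fun l : ℕ => p (l + m) * (l : ℝ) ^ 2 := fun m =>
    (hshift m).of_nonneg_of_le (fun l => mul_nonneg (hp _) (by positivity)) (hidle m)
  have hmean := h.ae_tendsto_deviation hp hs (ι := Unit) (w := fun _ => 1)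
    (fun _ => zero_le_one) (f := fun _ l => (l : ℝ)) (fun _ m => hids m) (C := C)
    (fun m => by
      rw [tsum_fintype, Fintype.sum_unique, one_mul]
      exact ENNReal.ofReal_le_ofReal (((hids m).tsum_le_tsum (hidle m) (hshift m)).trans
        (hshiftC m))) (N := N) hNs
  -- the estimator of the law
  have hone : ∀ m j, HasSum (fun l => p (l + m) * (if l = j then (1 : ℝ) else 0) ^ 2)
      (p (j + m)) := by
    intro m j
    have := hasSum_single (f := fun l => p (l + m) * (if l = j then (1 : ℝ) else 0) ^ 2) j
      fun l hl => by simp [hl]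
    simpa using this
  have hlaw := h.ae_tendsto_deviation hp hs (ι := ℕ) (w := fun j => ((j : ℝ) + 1) ^ 2)
    (fun j => by positivity) (f := fun j l => if l = j then (1 : ℝ) else 0)
    (fun j m => (hone m j).summable) (C := C)
    (fun m => by
      simp only [(hone m _).tsum_eq]
      have hsm := hshift m
      simp only [mul_comm (p _)] at hsm
      rw [← ENNReal.ofReal_tsum_of_nonneg (fun j => mul_nonneg (by positivity) (hp _)) hsm]
      refine ENNReal.ofReal_le_ofReal (le_of_eq_of_le ?_ (hshiftC m))
      exact tsum_congr fun j => mul_comm _ _) (N := N) hNs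
  have hlin : ∀ᵐ x ∂μ, ∀ M : ℕ, RunAverages p (fun k => ((k + 1 - M : ℕ) : ℝ)) x := by
    refine ae_all_iff.2 fun M =>
      h.ae_tendsto_sum_runs hp hs (f := fun k => ((k + 1 - M : ℕ) : ℝ)) ?_
    refine hsq.of_nonneg_of_le (fun k => mul_nonneg (hp k) (sq_nonneg _)) fun k => ?_
    have h1 : ((k + 1 - M : ℕ) : ℝ) ≤ (k : ℝ) + 1 := by exact_mod_cast Nat.sub_le _ _
    have := hp k
    gcongr
  have hind : ∀ᵐ x ∂μ, ∀ m : ℕ, RunAverages p ((Set.Ici m).indicator 1) x := by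
    refine ae_all_iff.2 fun m =>
      h.ae_tendsto_sum_runs hp hs (f := (Set.Ici m).indicator 1) ?_
    refine (hasSum_mul_indicator_Ici hs.summable m).summable.congr fun k => ?_
    by_cases hk : m ≤ k <;> simp [hk]
  filter_upwards [hmean, hlaw, hlin, hind, h.ae_tail_pos hp hs, h.frequently_zero] with
    x hmean hlaw hlin hind hpos hz
  obtain ⟨hinf, hlim⟩ := tendsto_lambdaStar_div (x := x) (γ := γ) fun ε hε =>
    exists_card_not_stopAt_le hz hlin hind hs.summable hpos (tendsto_tsum_excess hp hsq) hγ0 hε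
  have hSt : ∀ n, 1 ≤ n → StopAt γ x (lambdaStar γ x n) := by
    intro n hn
    obtain ⟨k, rfl⟩ := Nat.exists_eq_add_of_le' hn
    exact (lambdaStar_succ_spec hinf k).2
  have hlog : Tendsto (fun n => Nat.log 2 (lambdaStar γ x n)) atTop atTop :=
    tendsto_atTop.2 fun b => (eventually_ge_atTop (2 ^ b)).mono fun n hn =>
      Nat.le_log_of_pow_le one_lt_two (hn.trans (le_lambdaStar hinf n))
  have hage : ∀ᶠ n in atTop, tau x (lambdaStar γ x n) < Nat.log 2 (lambdaStar γ x n) := by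
    filter_upwards [eventually_ge_atTop 1] with n hn
    obtain ⟨⟨i, h1, h2, h3⟩, -⟩ := hSt n hn
    have := (tau_zero hz h1.le).1
    rw [h3] at this
    omega
  refine ⟨psi_le_lambdaStar hinf, hlim, ?_, ?_⟩
  · rw [Metric.tendsto_atTop]
    intro δ hδ
    obtain ⟨n₀, hn₀⟩ := eventually_atTop.1 ((tendsto_of_tendsto_sum_range hmean hlog hage).eventually
      (gt_mem_nhds (ENNReal.ofReal_pos.2 (pow_pos hδ 2))))
    refine ⟨n₀ + 1, fun n hn => ?_⟩
    have h1 := hn₀ n (by omega)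
    rw [tsum_fintype, Fintype.sum_unique, one_mul,
      ENNReal.ofReal_lt_ofReal_iff (pow_pos hδ 2)] at h1
    rw [Real.dist_eq, sub_zero, abs_abs, hStar_sub_residualMean hz (hSt n (by omega))]
    exact abs_lt_of_sq_lt_sq h1 hδ.le
  · set Z := ∑' l : ℕ, 1 / ((l : ℝ) + 1) ^ 2 with hZ
    have hZnn : 0 ≤ Z := tsum_nonneg fun l => by positivity
    rw [Metric.tendsto_atTop]
    intro ε hε
    set δ := ε / (2 * (Z + 1)) with hδdef
    have hδ : 0 < δ := by positivity
    obtain ⟨n₀, hn₀⟩ := eventually_atTop.1 ((tendsto_of_tendsto_sum_range hlaw hlog hage).eventually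
      (gt_mem_nhds (ENNReal.ofReal_pos.2 (pow_pos hδ 2))))
    refine ⟨n₀ + 1, fun n hn => ?_⟩
    have h1 := tsum_abs_le hδ (hn₀ n (by omega)).le
    rw [Real.dist_eq, sub_zero, abs_of_nonneg (tsum_nonneg fun l => abs_nonneg _),
      tsum_congr fun l => congrArg abs (pStar_sub_div hz (hSt n (by omega)) l)]
    refine h1.trans_lt ?_
    have h2 : δ * (Z + 1) = ε / 2 := by rw [hδdef]; field_simp
    rw [h2]
    linarith

end IsRenewalLaw

end Limits

/-! ### The conditional expectation of the residual waiting time -/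

/-- The event that the age at time `n` is `m`. -/
def ageEvent (n m : ℕ) : Set (ℕ → Fin 2) :=
  {x | m ≤ n ∧ x (n - m) = 0 ∧ ∀ i, n - m < i → i ≤ n → x i = 1}

lemma dependsOn_ageEvent (n m : ℕ) : DependsOn (fun x => x ∈ ageEvent n m) (Set.Iic n) := by
  have key : ∀ x y : ℕ → Fin 2, (∀ i ∈ Set.Iic n, x i = y i) → x ∈ ageEvent n m →
      y ∈ ageEvent n m := by
    rintro x y hxy ⟨h0, h1, h2⟩
    refine ⟨h0, by rwa [← hxy _ (Set.mem_Iic.2 (Nat.sub_le _ _))], fun i hi hi' => ?_⟩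
    rw [← hxy i hi']; exact h2 i hi hi'
  exact fun x y hxy => propext ⟨key x y hxy, key y x fun i hi => (hxy i hi).symm⟩

lemma mem_ageEvent_tau {x : ℕ → Fin 2} (hz : ∃ᶠ n in atTop, x n = 0) {n : ℕ}
    (hn : psi x ≤ n) : x ∈ ageEvent n (tau x n) :=
  tau_spec hz.exists hn

namespace IsRenewalLaw

variable {p : ℕ → ℝ} {μ : Measure (ℕ → Fin 2)}

/-- On an event decided by time `n` and contained in the event of age `m`, the residual waiting
time has mean `residualMean p m`. -/
lemma setIntegral_sigma (h : IsRenewalLaw p μ) (hp : ∀ k, 0 ≤ p k) (hs : HasSum p 1) {n m : ℕ}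
    (hf : Summable fun l : ℕ => p (l + m) * (l : ℝ) ^ 2)
    (hσ : Integrable (fun x => (sigma x n : ℝ)) μ)
    {C : Set (ℕ → Fin 2)} (hC : DependsOn (fun x => x ∈ C) (Set.Iic n)) :
    ∫ x in C ∩ ageEvent n m, (sigma x n : ℝ) ∂μ =
      μ.real (C ∩ ageEvent n m) * residualMean p m (fun l => l) := by
  have := h.isProbabilityMeasure
  by_cases hmn : m ≤ n
  swap
  · have : ageEvent n m = ∅ := by
      ext x
      simp [ageEvent, hmn]
    simp [this]
  have hmeas : MeasurableSet (C ∩ ageEvent n m) :=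
    (measurableSet_of_dependsOn hC).inter (measurableSet_of_dependsOn (dependsOn_ageEvent n m))
  -- on the event of age `m` the path up to `n` is determined by the path up to `n - m`
  set fill : (ℕ → Fin 2) → (ℕ → Fin 2) := fun x i => if i ≤ n - m then x i else 1 with hfill
  set H : Set (ℕ → Fin 2) := {x | x (n - m) = 0 ∧ fill x ∈ C} with hH
  have hHdep : DependsOn (fun x => x ∈ H) (Set.Iic (n - m)) := by
    intro x y hxy
    have he : fill x = fill y := by
      funext i
      by_cases hi : i ≤ n - m
      · simp only [hfill, if_pos hi]; exact hxy i hi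
      · simp only [hfill, if_neg hi]
    simp only [hH, Set.mem_ofPred_eq, he, hxy (n - m) (Set.mem_Iic.2 le_rfl)]
  have hgs := hasSum_centred hp hs.summable hf
  have hgi : Integrable (centred p m fun l => (l : ℝ)) (runLaw p) := by
    refine integrable_runLaw hp ?_
    refine (summable_mul_of_sq hp hs.summable
      (f := fun r => |centred p m (fun l => (l : ℝ)) r|) ?_)
    simpa only [sq_abs] using (hasSum_centred_sq hp hs.summable hf).summable
  obtain ⟨-, h2⟩ := h.integrable_mul_sigma hp hs (φ := H.indicator 1) (s := n - m)
    (fun x y hxy => by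
      have hiff : x ∈ H ↔ y ∈ H := iff_of_eq (hHdep hxy)
      by_cases hx : x ∈ H
      · simp [hx, hiff.1 hx]
      · simp [hx, mt hiff.2 hx])
    (fun x hx => Set.indicator_of_notMem (fun hm => hx hm.1) _) hgi
  rw [integral_runLaw hp, hgs.tsum_eq, mul_zero] at h2
  have hae : (fun x => H.indicator (1 : (ℕ → Fin 2) → ℝ) x *
      centred p m (fun l => (l : ℝ)) (sigma x (n - m))) =ᵐ[μ]
      (C ∩ ageEvent n m).indicator
        fun x => (sigma x n : ℝ) - residualMean p m (fun l => l) := by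
    filter_upwards [h.frequently_zero] with x hz
    by_cases hx : m ≤ sigma x (n - m)
    · have hones : ∀ i, n - m < i → i ≤ n → x i = 1 := fun i hi hi' =>
        (sigma_spec hz (n - m)).1 i hi (by omega)
      have hiff : x ∈ H ↔ x ∈ C ∩ ageEvent n m := by
        have hCx : fill x ∈ C ↔ x ∈ C := by
          refine iff_of_eq (hC fun i hi => ?_)
          by_cases hi' : i ≤ n - m
          · simp only [hfill, if_pos hi']
          · simp only [hfill, if_neg hi']
            exact (hones i (by omega) hi).symm
        simp only [hH, Set.mem_ofPred_eq, Set.mem_inter_iff, ageEvent, hCx]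
        tauto
      have hsig : sigma x n = sigma x (n - m) - m := by
        have := sigma_add hz hx
        rwa [Nat.sub_add_cancel hmn] at this
      by_cases hxH : x ∈ H
      · rw [Set.indicator_of_mem hxH, Set.indicator_of_mem (hiff.1 hxH), centred, if_pos hx, hsig]
        simp
      · rw [Set.indicator_of_notMem hxH, Set.indicator_of_notMem (mt hiff.2 hxH), zero_mul]
    · rw [centred_of_lt (not_le.1 hx), mul_zero, Set.indicator_of_notMem]
      rintro ⟨-, h0, h1, h3⟩
      have := h3 (n - m + sigma x (n - m) + 1) (by omega) (by omega)
      rw [(sigma_spec hz (n - m)).2] at this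
      simp at this
  rw [integral_congr_ae hae, integral_indicator hmeas,
    integral_sub hσ.integrableOn (integrable_const _), setIntegral_const, smul_eq_mul] at h2
  linarith

end IsRenewalLaw

section Theta

/-- The σ-algebra generated by `X 0, …, X n`. -/
abbrev observed {Ω : Type*} (X : ℕ → Ω → Fin 2) (n : ℕ) : MeasurableSpace Ω :=
  MeasurableSpace.comap (fun ω (i : Fin (n + 1)) => X i ω) inferInstance

/-- The events decided by `X 0, …, X n` are the preimages under the path of the sets that depend on
the coordinates up to `n`. -/
lemma measurableSet_observed_iff {Ω : Type*} {X : ℕ → Ω → Fin 2} (n : ℕ) (s : Set Ω) :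
    MeasurableSet[observed X n] s ↔
      ∃ C : Set (ℕ → Fin 2), DependsOn (fun x => x ∈ C) (Set.Iic n) ∧ path X ⁻¹' C = s := by
  constructor
  · rintro ⟨A, -, rfl⟩
    refine ⟨{x | (fun i : Fin (n + 1) => x i) ∈ A}, fun x y hxy => ?_, rfl⟩
    have : (fun i : Fin (n + 1) => x i) = fun i : Fin (n + 1) => y i :=
      funext fun i => hxy i (Set.mem_Iic.2 (by omega))
    simp only [Set.mem_ofPred_eq, this]
  · rintro ⟨C, hC, rfl⟩
    refine ⟨{a | (fun i => if h : i < n + 1 then a ⟨i, h⟩ else 0) ∈ C},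
      (Set.to_countable _).measurableSet, ?_⟩
    ext ω
    refine iff_of_eq (hC fun i hi => ?_)
    simp only [Set.mem_Iic] at hi
    rw [dif_pos (by omega)]
    rfl

variable {Ω : Type*} [MeasurableSpace Ω] {P : Measure Ω} {X : ℕ → Ω → Fin 2} {p : ℕ → ℝ}

lemma measurable_path (hX : ∀ n, Measurable (X n)) : Measurable (path X) :=
  measurable_pi_lambda _ hX

/-- Once a zero has been seen, the conditional expectation of the residual waiting time is its mean
at the current age. -/
lemma ae_theta_eq [IsProbabilityMeasure P] (hXm : ∀ n, Measurable (X n))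
    (h : IsRenewalLaw p (P.map (path X))) (hp : ∀ k, 0 ≤ p k) (hs : HasSum p 1)
    (hf : ∀ m, Summable fun l : ℕ => p (l + m) * (l : ℝ) ^ 2)
    (hσ : ∀ n, Integrable (fun ω => (sigma (path X ω) n : ℝ)) P) :
    ∀ᵐ ω ∂P, ∀ n, psi (path X ω) ≤ n →
      theta P X n ω = residualMean p (tau (path X ω) n) (fun l => l) := by
  have hpath := measurable_path hXm
  have hz : ∀ᵐ ω ∂P, ∃ᶠ n in atTop, path X ω n = 0 :=
    ae_of_ae_map hpath.aemeasurable h.frequently_zero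
  have hσm : ∀ n, Measurable fun x : ℕ → Fin 2 => (sigma x n : ℝ) := fun n =>
    measurable_from_nat.comp (measurable_sigma n)
  have hmain : ∀ᵐ ω ∂P, ∀ n m, path X ω ∈ ageEvent n m →
      theta P X n ω = residualMean p m (fun l => l) := by
    refine ae_all_iff.2 fun n => ae_all_iff.2 fun m => ?_
    have hle : observed X n ≤ ‹MeasurableSpace Ω› :=
      (measurable_pi_lambda _ fun i : Fin (n + 1) => hXm i).comap_le
    set E : Set Ω := path X ⁻¹' ageEvent n m with hE
    have hEF : MeasurableSet[observed X n] E :=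
      (measurableSet_observed_iff n _).2 ⟨_, dependsOn_ageEvent n m, rfl⟩
    have h1 : P[E.indicator (fun ω => (sigma (path X ω) n : ℝ)) | observed X n] =ᵐ[P]
        E.indicator (theta P X n) := condExp_indicator (hσ n) hEF
    have h2 : E.indicator (fun _ => residualMean p m (fun l => (l : ℝ))) =ᵐ[P]
        P[E.indicator (fun ω => (sigma (path X ω) n : ℝ)) | observed X n] := by
      refine ae_eq_condExp_of_forall_setIntegral_eq hle ((hσ n).indicator (hle _ hEF))
        (fun s _ _ => ((integrable_const _).indicator (hle _ hEF)).integrableOn)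
        (fun s hsF _ => ?_)
        (stronglyMeasurable_const.indicator hEF).aestronglyMeasurable
      obtain ⟨C, hC, rfl⟩ := (measurableSet_observed_iff n s).1 hsF
      have hmeas : MeasurableSet (C ∩ ageEvent n m) :=
        (measurableSet_of_dependsOn hC).inter
          (measurableSet_of_dependsOn (dependsOn_ageEvent n m))
      rw [setIntegral_indicator (hle _ hEF), setIntegral_indicator (hle _ hEF), setIntegral_const,
        smul_eq_mul]
      have h3 := h.setIntegral_sigma hp hs (hf m) ((integrable_map_measure
        (hσm n).aestronglyMeasurable hpath.aemeasurable).2 (hσ n)) hC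
      rw [setIntegral_map hmeas (hσm n).aestronglyMeasurable hpath.aemeasurable,
        measureReal_def, Measure.map_apply hpath hmeas] at h3
      exact h3.symm
    filter_upwards [h1, h2] with ω h1 h2 hω
    have hωE : ω ∈ E := hω
    rw [Set.indicator_of_mem hωE] at h1 h2
    rw [← h1, ← h2]
  filter_upwards [hmain, hz] with ω hω hz n hn
  exact hω n _ (mem_ageEvent_tau hz hn)

end Theta

end BinaryRenewal

theorem theorem2 {Ω : Type*} [MeasurableSpace Ω] (P : Measure Ω) [IsProbabilityMeasure P]
    (X : ℕ → Ω → Fin 2) (p : ℕ → ℝ) (hp_nonneg : ∀ k, 0 ≤ p k) (hp_sum : HasSum p 1)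
    (hX : BinaryRenewal.IsRenewalProcess p P X)
    (α : ℝ) (hα : 1 < α) (hmoment : Summable (fun k : ℕ => (k : ℝ) ^ (α + 1) * p k))
    (γ : ℝ) (hγ_pos : 0 < γ) (hγ_lt : γ < 1 / 3) :
    (∀ n, Integrable (fun ω => (BinaryRenewal.sigma (BinaryRenewal.path X ω) n : ℝ)) P) ∧
    ∀ᵐ ω ∂P,
      Tendsto (fun n : ℕ =>
        (BinaryRenewal.lambdaStar γ (BinaryRenewal.path X ω) n : ℝ) / (n : ℝ)) atTop (𝓝 1) ∧
      Tendsto (fun n : ℕ =>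
        |BinaryRenewal.hStar γ (BinaryRenewal.path X ω) n -
          BinaryRenewal.theta P X
            (BinaryRenewal.lambdaStar γ (BinaryRenewal.path X ω) n) ω|) atTop (𝓝 0) ∧
      Tendsto (fun n : ℕ =>
        ∑' l : ℕ, |BinaryRenewal.pStar γ (BinaryRenewal.path X ω) n l -
          p (l + BinaryRenewal.tau (BinaryRenewal.path X ω)
              (BinaryRenewal.lambdaStar γ (BinaryRenewal.path X ω) n)) /
            ∑' i : ℕ, p (i + BinaryRenewal.tau (BinaryRenewal.path X ω)
              (BinaryRenewal.lambdaStar γ (BinaryRenewal.path X ω) n))|) atTop (𝓝 0) := by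
  obtain ⟨ν, hν, hlaw⟩ := hX.law
  have hpath := BinaryRenewal.measurable_path hX.measurable
  have hR : BinaryRenewal.IsRenewalLaw p (P.map (BinaryRenewal.path X)) := by
    change BinaryRenewal.IsRenewalLaw p (P.map fun ω n => X n ω)
    rw [hlaw]
    exact hν.isRenewalLaw hp_nonneg
  have hσ : ∀ n, Integrable
      (fun ω => (BinaryRenewal.sigma (BinaryRenewal.path X ω) n : ℝ)) P := by
    intro n
    have h := hν.integrable_sigma hp_nonneg hp_sum.summable hα hmoment n
    rw [← hlaw] at h
    exact h.comp_measurable hpath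
  refine ⟨hσ, ?_⟩
  have hsq := BinaryRenewal.summable_succ_sq_mul hp_sum.summable hp_nonneg hα hmoment
  have hf : ∀ m, Summable fun l : ℕ => p (l + m) * (l : ℝ) ^ 2 := by
    intro m
    refine ((summable_nat_add_iff m).2 hsq).of_nonneg_of_le
      (fun l => mul_nonneg (hp_nonneg _) (by positivity)) fun l => ?_
    have := hp_nonneg (l + m)
    gcongr
    push_cast
    linarith [Nat.cast_nonneg (α := ℝ) m]
  filter_upwards [ae_of_ae_map hpath.aemeasurable
      (hR.ae_limits hp_nonneg hp_sum hsq hγ_pos (by linarith)),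
    BinaryRenewal.ae_theta_eq hX.measurable hR hp_nonneg hp_sum hf hσ] with ω hω hθ
  obtain ⟨hψ, h1, h2, h3⟩ := hω
  refine ⟨h1, ?_, h3⟩
  simpa only [hθ _ (hψ _)] using h2
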